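/- Let $z$ be an indeterminate and $R=\mathbb{Z}[z]$. For $k\ge 1$ let $A_k$ be the set of set partitions of $\{1,\dots,k,1',\dots,k'\}$, drawn as diagrams with top row $1,\dots,k$ and bottom row $1',\dots,k'$. The partition algebra $\mathcal{A}_k(z)$ is the free $R$-module on $A_k$ with product $\rho_1\rho_2=z^{\ell}\,\rho_1\circ\rho_2$, where $\rho_1\circ\rho_2$ is obtained by placing $\rho_1$ above $\rho_2$, identifying the bottom row of $\rho_1$ with the top row of $\rho_2$, and deleting the $\ell$ components that lie entirely in the middle row. For $k\ge0$ let $\mathcal{A}_{k+\frac12}(z)$ be the subalgebra of $\mathcal{A}_{k+1}(z)$ generated by the diagrams in which $k+1$ and $(k+1)'$ lie in the same block. $\mathcal{A}_k(z)$ is regarded as a subalgebra of $\mathcal{A}_{k+1}(z)$ by adding the block $\{k+1,(k+1)'\}$ to diagrams. Let $s_i$ be the diagram with blocks $\{i,(i+1)'\}$, $\{i+1,i'\}$; $p_i$ the diagram with blocks $\{i\}$, $\{i'\}$; $p_{i+\frac12}$ the diagram with block $\{i,i+1,i',(i+1)'\}$; in each case the remaining blocks are $\{j,j'\}$ for all other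 $j$. Define elements $L_i,\sigma_i,L_{i+\frac12},\sigma_{i+\frac12}$ recursively by $L_0=0$, $L_1=p_1$, $\sigma_1=1$, $\sigma_2=s_1$, $L_{\frac12}=0$, $\sigma_{\frac12}=\sigma_{1+\frac12}=1$; for $i\ge1$, $$L_{i+1}=-s_iL_ip_{i+\frac12}-p_{i+\frac12}L_is_i+p_{i+\frac12}L_ip_{i+1}p_{i+\frac12}+s_iL_is_i+\sigma_{i+1},$$ $$L_{i+\frac12}=-L_ip_{i+\frac12}-p_{i+\frac12}L_i+p_{i+\frac12}L_ip_ip_{i+\frac12}+s_iL_{i-\frac12}s_i+\sigma_{i+\frac12};$$ and for $i\ge2$, $$\begin{aligned}\sigma_{i+1}={}&s_{i-1}s_i\sigma_is_is_{i-1}+s_ip_{i-\frac12}L_{i-1}s_ip_{i-\frac12}s_i+p_{i-\frac12}L_{i-1}s_ip_{i-\frac12}\\&-s_ip_{i-\frac12}L_{i-1}s_{i-1}p_{i+\frac12}p_ip_{i-\frac12}-p_{i-\frac12}p_ip_{i+\frac12}s_{i-1}L_{i-1}p_{i-\frac12}s_i,\end{aligned}$$ $$\begin{aligned}\sigma_{i+\frac12}={}&s_{i-1}s_i\sigma_{i-\frac12}s_is_{i-1}+p_{i-\frac12}L_{i-1}s_ip_{i-\frac12}s_i+s_ip_{i-\frac12}L_{i-1}s_ip_{i-\frac12}\\&-p_{i-\frac12}L_{i-1}s_{i-1}p_{i+\frac12}p_ip_{i-\frac12}-s_ip_{i-\frac12}p_ip_{i+\frac12}s_{i-1}L_{i-1}p_{i-\frac12}s_i.\end{aligned}$$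 Theorem. For every $k=0,1,2,\dots$: (1) the element $z_{k+\frac12}=L_{\frac12}+L_1+L_{1+\frac12}+\cdots+L_k+L_{k+\frac12}$ lies in $\mathcal{A}_{k+\frac12}(z)$ and is central in $\mathcal{A}_{k+\frac12}(z)$; (2) the element $z_{k+1}=L_{\frac12}+L_1+L_{1+\frac12}+\cdots+L_{k+\frac12}+L_{k+1}$ is central in $\mathcal{A}_{k+1}(z)$. -/

import Mathlib

open scoped Polynomial

namespace PartitionAlg

/-- The vertices of a diagram: `Sum.inl j` is the vertex `j + 1` of the top row,
`Sum.inr j` is the vertex `(j + 1)'` of the bottom row. -/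
abbrev Vertex (k : ℕ) : Type := Fin k ⊕ Fin k

/-- Set partitions of `{1, …, k, 1', …, k'}`, encoded as equivalence relations
(two vertices are related when they lie in the same block). -/
abbrev Diagram (k : ℕ) : Type := Setoid (Vertex k)

/-- The vertices of two stacked diagrams: top, middle and bottom row. -/
abbrev Vertex3 (k : ℕ) : Type := Fin k ⊕ Fin k ⊕ Fin k

/-- The rows of the upper diagram inside the stack (top and middle row). -/
def upper (k : ℕ) : Vertex k → Vertex3 k := Sum.map id Sum.inl

/-- The rows of the lower diagram inside the stack (middle and bottom row). -/
def lower (k : ℕ) : Vertex k → Vertex3 k := Sum.inr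

/-- The outer rows of the stack (top and bottom row). -/
def outer (k : ℕ) : Vertex k → Vertex3 k := Sum.map id Sum.inr

/-- The connected components of the graph obtained by placing `d` above `e` and identifying the
bottom row of `d` with the top row of `e`. -/
def stack {k : ℕ} (d e : Diagram k) : Setoid (Vertex3 k) :=
  d.map (upper k) ⊔ e.map (lower k)

/-- The composition `d ∘ e` of diagrams, `d` placed above `e`. -/
def comp {k : ℕ} (d e : Diagram k) : Diagram k := (stack d e).comap (outer k)

/-- The number of components of the stack of `d` and `e` that lie entirely in the middle row. -/
noncomputable def loops {k : ℕ} (d e : Diagram k) : ℕ :=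
  Nat.card {c : Quotient (stack d e) // ∀ v : Vertex k, Quotient.mk (stack d e) (outer k v) ≠ c}

/-- The identity diagram, with blocks `{j, j'}`. -/
def idDiagram (k : ℕ) : Diagram k := Setoid.ker (Sum.elim id id : Vertex k → Fin k)

/-- The partition algebra `𝒜_k(z)` over `ℤ[z]`: the free module on the diagrams. -/
def PartitionAlgebra (k : ℕ) : Type := Diagram k →₀ ℤ[X]

noncomputable instance (k : ℕ) : AddCommGroup (PartitionAlgebra k) :=
  inferInstanceAs (AddCommGroup (Diagram k →₀ ℤ[X]))

noncomputable instance (k : ℕ) : Module ℤ[X] (PartitionAlgebra k) :=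
  inferInstanceAs (Module ℤ[X] (Diagram k →₀ ℤ[X]))

/-- The basis element of `𝒜_k(z)` given by a diagram. -/
noncomputable def diag {k : ℕ} (d : Diagram k) : PartitionAlgebra k :=
  (Finsupp.single d 1 : Diagram k →₀ ℤ[X])

/-- The bilinear product of `𝒜_k(z)`, determined on diagrams by `d e = z ^ ℓ • (d ∘ e)`, where
`ℓ` is the number of components removed from the middle row. -/
noncomputable def mulLin (k : ℕ) :
    PartitionAlgebra k →ₗ[ℤ[X]] PartitionAlgebra k →ₗ[ℤ[X]] PartitionAlgebra k :=
  Finsupp.lift (PartitionAlgebra k →ₗ[ℤ[X]] PartitionAlgebra k) ℤ[X] (Diagram k) fun d =>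
    Finsupp.lift (PartitionAlgebra k) ℤ[X] (Diagram k) fun e =>
      (Polynomial.X ^ loops d e : ℤ[X]) • diag (comp d e)

/-! Associativity and the unit laws. They are checked by counting labellings: the matrix of a
diagram records which labellings of the two rows by `Bool` are constant on blocks; it determines
the diagram, and composition turns into the matrix product up to the factor `2 ^ loops`. -/

/-- A labelling of the three rows. -/
def label3 {k : ℕ} (a c b : Fin k → Bool) : Vertex3 k → Bool := Sum.elim a (Sum.elim c b)

theorem stack_le_iff {k : ℕ} (d e : Diagram k) (a c b : Fin k → Bool) :
    stack d e ≤ Setoid.ker (label3 a c b) ↔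
      d ≤ Setoid.ker (Sum.elim a c) ∧ e ≤ Setoid.ker (Sum.elim c b) := by
  have key : ∀ (r : Diagram k) (f : Vertex k → Vertex3 k) (g : Vertex3 k → Bool),
      r.map f ≤ Setoid.ker g ↔ r ≤ Setoid.ker (g ∘ f) := by
    intro r f g
    constructor
    · intro h x y hxy
      exact h (Setoid.le_comap_map hxy)
    · intro h
      refine Setoid.eqvGen_le ?_
      rintro _ _ ⟨x, y, hxy, rfl, rfl⟩
      exact h hxy
  have h1 : label3 a c b ∘ upper k = Sum.elim a c := by
    funext v; rcases v with v | v <;> rfl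
  have h2 : label3 a c b ∘ lower k = Sum.elim c b := by
    funext v; rcases v with v | v <;> rfl
  rw [stack, sup_le_iff, key, key, h1, h2]

theorem card_extensions {X Q : Type} [Finite Q] (m : X → Q) (u : X → Bool)
    (h : ∀ x y, m x = m y → u x = u y) :
    Nat.card {g : Q → Bool // ∀ x, g (m x) = u x} = 2 ^ Nat.card {q : Q // ∀ x, m x ≠ q} := by
  classical
  have E : {g : Q → Bool // ∀ x, g (m x) = u x} ≃ ({q : Q // ∀ x, m x ≠ q} → Bool) :=
    { toFun := fun g q => g.1 q.1
      invFun := fun f => ⟨fun q => if hq : ∀ x, m x ≠ q then f ⟨q, hq⟩ else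
          u (Classical.choose (not_forall_not.mp hq)), fun x => by
            have hq : ¬ ∀ y, m y ≠ m x := fun H => H x rfl
            simp only [dif_neg hq]
            exact h _ _ (Classical.choose_spec (not_forall_not.mp hq))⟩
      left_inv := by
        rintro ⟨g, hg⟩
        ext q
        by_cases hq : ∀ x, m x ≠ q
        · simp only [dif_pos hq]
        · simp only [dif_neg hq]
          rw [← hg, Classical.choose_spec (not_forall_not.mp hq)]
      right_inv := by
        intro f
        funext q
        simp only [dif_pos q.2] }
  rw [Nat.card_congr E, Nat.card_fun, Nat.card_eq_fintype_card, Fintype.card_bool]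

open Classical in
/-- The matrix of a diagram. -/
noncomputable def mat {k : ℕ} (d : Diagram k) : Matrix (Fin k → Bool) (Fin k → Bool) ℕ :=
  fun a b => if d ≤ Setoid.ker (Sum.elim a b) then 1 else 0

theorem mat_mul {k : ℕ} (d e : Diagram k) : mat d * mat e = 2 ^ loops d e • mat (comp d e) := by
  classical
  ext a b
  have hcount : (mat d * mat e) a b
      = Nat.card {c : Fin k → Bool // stack d e ≤ Setoid.ker (label3 a c b)} := by
    rw [Matrix.mul_apply, Nat.card_eq_fintype_card, Fintype.card_subtype, Finset.card_filter]
    refine Finset.sum_congr rfl fun c _ => ?_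
    rw [stack_le_iff]
    by_cases h1 : d ≤ Setoid.ker (Sum.elim a c) <;>
      by_cases h2 : e ≤ Setoid.ker (Sum.elim c b) <;> simp [mat, h1, h2]
  let m : Vertex k → Quotient (stack d e) := fun v => Quotient.mk (stack d e) (outer k v)
  have E : {c : Fin k → Bool // stack d e ≤ Setoid.ker (label3 a c b)} ≃
      {g : Quotient (stack d e) → Bool // ∀ v, g (m v) = Sum.elim a b v} :=
    { toFun := fun c => ⟨Quotient.lift (label3 a c.1 b) fun x y hxy => c.2 hxy, fun v => by
        rcases v with v | v <;> rfl⟩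
      invFun := fun g => ⟨fun i => g.1 (Quotient.mk (stack d e) (Sum.inr (Sum.inl i))), by
        have : label3 a (fun i => g.1 (Quotient.mk (stack d e) (Sum.inr (Sum.inl i)))) b
            = fun x => g.1 (Quotient.mk (stack d e) x) := by
          funext x
          rcases x with x | x | x
          · exact (g.2 (Sum.inl x)).symm
          · rfl
          · exact (g.2 (Sum.inr x)).symm
        rw [this]
        intro x y hxy
        exact congrArg g.1 (Quotient.sound hxy)⟩
      left_inv := fun c => rfl
      right_inv := by
        rintro ⟨g, hg⟩
        ext q
        induction q using Quotient.inductionOn with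
        | h x =>
          rcases x with x | x | x
          · exact (hg (Sum.inl x)).symm
          · rfl
          · exact (hg (Sum.inr x)).symm }
  rw [hcount, Nat.card_congr E, Matrix.smul_apply, mat]
  by_cases h : comp d e ≤ Setoid.ker (Sum.elim a b)
  · rw [if_pos h, card_extensions m _ fun x y hxy =>
      h (show stack d e (outer k x) (outer k y) from Quotient.exact hxy)]
    simp [loops, m]
  · rw [if_neg h, smul_zero]
    have : IsEmpty {g : Quotient (stack d e) → Bool // ∀ v, g (m v) = Sum.elim a b v} := by
      refine ⟨fun g => h fun x y hxy => ?_⟩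
      have : m x = m y := Quotient.sound hxy
      rw [Setoid.ker_def, ← g.2 x, ← g.2 y, this]
    exact Nat.card_of_isEmpty

theorem mat_const {k : ℕ} (d : Diagram k) : mat d (fun _ => true) (fun _ => true) = 1 := by
  rw [mat, if_pos]
  intro x y _
  rcases x with x | x <;> rcases y with y | y <;> rfl

theorem mat_injective {k : ℕ} {d e : Diagram k} (h : mat d = mat e) : d = e := by
  classical
  have key : ∀ d e : Diagram k, mat d = mat e → e ≤ d := by
    intro d e h x y hxy
    have h1 := congrFun (congrFun h fun i => decide (d x (Sum.inl i)))
      fun i => decide (d x (Sum.inr i))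
    have h2 : (Sum.elim (fun i => decide (d x (Sum.inl i))) fun i => decide (d x (Sum.inr i)))
        = fun v => decide (d x v) := by
      funext v; rcases v with v | v <;> rfl
    have hd : d ≤ Setoid.ker fun v => decide (d x v) := by
      intro v w hvw
      rw [Setoid.ker_def, decide_eq_decide]
      exact ⟨fun H => d.trans' H hvw, fun H => d.trans' H (d.symm' hvw)⟩
    have he : e ≤ Setoid.ker fun v => decide (d x v) := by
      by_contra hne
      rw [mat, mat, h2, if_pos hd, if_neg hne] at h1
      exact one_ne_zero h1
    have h3 := he hxy
    rw [Setoid.ker_def, decide_eq_decide] at h3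
    exact h3.mp (d.refl' x)
  exact le_antisymm (key e d h.symm) (key d e h)

theorem eq_of_smul_mat {k : ℕ} {d e : Diagram k} {m n : ℕ}
    (h : 2 ^ m • mat d = 2 ^ n • mat e) : m = n ∧ d = e := by
  have h1 := congrFun (congrFun h fun _ => true) fun _ => true
  rw [Matrix.smul_apply, Matrix.smul_apply, mat_const, mat_const] at h1
  have hmn : m = n := Nat.pow_right_injective le_rfl (by simpa using h1)
  subst hmn
  refine ⟨rfl, mat_injective ?_⟩
  ext a b
  have h2 := congrFun (congrFun h a) b
  rw [Matrix.smul_apply, Matrix.smul_apply, smul_eq_mul, smul_eq_mul] at h2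
  exact Nat.eq_of_mul_eq_mul_left (by positivity) h2

theorem comp_assoc {k : ℕ} (d e f : Diagram k) :
    loops d e + loops (comp d e) f = loops e f + loops d (comp e f) ∧
      comp (comp d e) f = comp d (comp e f) := by
  apply eq_of_smul_mat
  rw [pow_add, mul_smul, ← mat_mul, pow_add, mul_smul, ← mat_mul, ← Matrix.smul_mul, ← mat_mul,
    ← Matrix.mul_smul, ← mat_mul, Matrix.mul_assoc]

theorem mat_id (k : ℕ) : mat (idDiagram k) = 1 := by
  classical
  ext a b
  rw [mat, Matrix.one_apply]
  congr 1
  rw [eq_iff_iff]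
  constructor
  · intro h
    funext i
    exact h (show idDiagram k (Sum.inl i) (Sum.inr i) from rfl)
  · rintro rfl x y hxy
    rcases x with x | x <;> rcases y with y | y <;> exact congrArg a hxy

theorem id_comp {k : ℕ} (d : Diagram k) :
    loops (idDiagram k) d = 0 ∧ comp (idDiagram k) d = d := by
  apply eq_of_smul_mat
  rw [← mat_mul, mat_id, one_mul, pow_zero, one_smul]

theorem comp_id {k : ℕ} (d : Diagram k) :
    loops d (idDiagram k) = 0 ∧ comp d (idDiagram k) = d := by
  apply eq_of_smul_mat
  rw [← mat_mul, mat_id, mul_one, pow_zero, one_smul]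

theorem mulLin_diag {k : ℕ} (d e : Diagram k) :
    mulLin k (diag d) (diag e) = (Polynomial.X ^ loops d e : ℤ[X]) • diag (comp d e) := by
  have h : ∀ (M : Type) [AddCommGroup M] [Module ℤ[X] M] (f : Diagram k → M) (d : Diagram k),
      Finsupp.lift M ℤ[X] (Diagram k) f (Finsupp.single d 1) = f d := by
    intro M _ _ f d
    simp [Finsupp.lift_apply]
  have h1 : mulLin k (diag d) = Finsupp.lift (PartitionAlgebra k) ℤ[X] (Diagram k) fun e =>
      (Polynomial.X ^ loops d e : ℤ[X]) • diag (comp d e) := h _ _ d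
  rw [h1]
  exact h _ _ e

theorem linearMap_ext {k : ℕ} {M : Type} [AddCommGroup M] [Module ℤ[X] M]
    {f g : PartitionAlgebra k →ₗ[ℤ[X]] M} (h : ∀ d, f (diag d) = g (diag d)) : f = g :=
  Finsupp.lhom_ext' fun d => LinearMap.ext_ring (h d)

theorem mulLin_assoc {k : ℕ} (x y w : PartitionAlgebra k) :
    mulLin k (mulLin k x y) w = mulLin k x (mulLin k y w) := by
  have h1 : ∀ (d e : Diagram k) (w : PartitionAlgebra k),
      mulLin k (mulLin k (diag d) (diag e)) w = mulLin k (diag d) (mulLin k (diag e) w) := by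
    intro d e w
    have h : mulLin k (mulLin k (diag d) (diag e))
        = (mulLin k (diag d)).comp (mulLin k (diag e)) := linearMap_ext fun f => by
      simp only [LinearMap.comp_apply, mulLin_diag, map_smul, LinearMap.smul_apply, smul_smul,
        ← pow_add, (comp_assoc d e f).1, (comp_assoc d e f).2]
    rw [h, LinearMap.comp_apply]
  have h2 : ∀ (d : Diagram k) (y w : PartitionAlgebra k),
      mulLin k (mulLin k (diag d) y) w = mulLin k (diag d) (mulLin k y w) := by
    intro d y w
    have h : ((mulLin k).flip w).comp (mulLin k (diag d))
        = (mulLin k (diag d)).comp ((mulLin k).flip w) := linearMap_ext fun e => by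
      simp only [LinearMap.comp_apply, LinearMap.flip_apply, h1]
    exact LinearMap.congr_fun h y
  have h : ((mulLin k).flip w).comp ((mulLin k).flip y) = (mulLin k).flip (mulLin k y w) :=
    linearMap_ext fun d => by
      simp only [LinearMap.comp_apply, LinearMap.flip_apply, h2]
  exact LinearMap.congr_fun h x

theorem one_mulLin {k : ℕ} (x : PartitionAlgebra k) : mulLin k (diag (idDiagram k)) x = x := by
  have h : mulLin k (diag (idDiagram k)) = LinearMap.id := linearMap_ext fun d => by
    rw [mulLin_diag, (id_comp d).1, (id_comp d).2, pow_zero, one_smul, LinearMap.id_apply]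
  rw [h, LinearMap.id_apply]

theorem mulLin_one {k : ℕ} (x : PartitionAlgebra k) : mulLin k x (diag (idDiagram k)) = x := by
  have h : (mulLin k).flip (diag (idDiagram k)) = LinearMap.id := linearMap_ext fun d => by
    rw [LinearMap.flip_apply, mulLin_diag, (comp_id d).1, (comp_id d).2, pow_zero, one_smul,
      LinearMap.id_apply]
  rw [← LinearMap.flip_apply, h, LinearMap.id_apply]

noncomputable instance (k : ℕ) : Ring (PartitionAlgebra k) where
  mul x y := mulLin k x y
  one := diag (idDiagram k)
  left_distrib x y w := map_add (mulLin k x) y w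
  right_distrib x y w := LinearMap.map_add₂ (mulLin k) x y w
  zero_mul x := LinearMap.map_zero₂ (mulLin k) x
  mul_zero x := map_zero (mulLin k x)
  mul_assoc := mulLin_assoc
  one_mul := one_mulLin
  mul_one := mulLin_one
  neg_add_cancel := neg_add_cancel
  zsmul := fun n x => n • x
  zsmul_zero' := SubNegMonoid.zsmul_zero'
  zsmul_succ' := SubNegMonoid.zsmul_succ'
  zsmul_neg' := SubNegMonoid.zsmul_neg'
  nsmul := fun n x => n • x
  nsmul_zero := AddMonoid.nsmul_zero
  nsmul_succ := AddMonoid.nsmul_succ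
  sub_eq_add_neg := sub_eq_add_neg

noncomputable instance (k : ℕ) : Algebra ℤ[X] (PartitionAlgebra k) :=
  Algebra.ofModule (fun r x y => LinearMap.map_smul₂ (mulLin k) r x y)
    (fun r x y => map_smul (mulLin k x) r y)

theorem diag_mul_diag {k : ℕ} (d e : Diagram k) :
    diag d * diag e = (Polynomial.X ^ loops d e : ℤ[X]) • diag (comp d e) :=
  mulLin_diag d e

/-- The subalgebra `𝒜_{k+1/2}(z)` of `𝒜_{k+1}(z)`, generated by the diagrams in which the vertices
`k + 1` and `(k + 1)'` lie in the same block. -/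
noncomputable def halfAlgebra (k : ℕ) : Subalgebra ℤ[X] (PartitionAlgebra (k + 1)) :=
  Algebra.adjoin ℤ[X]
    {x | ∃ d : Diagram (k + 1), d (Sum.inl (Fin.last k)) (Sum.inr (Fin.last k)) ∧ x = diag d}

/-! The generators. Diagrams are given by labellings of the vertices, two vertices lying in the same
block when they have the same label. Indices are the usual ones, starting from `1`, so that
`j : Fin n` is the vertex number `j + 1`. -/

/-- `s_i ∈ 𝒜_n(z)`, for `1 ≤ i ≤ n - 1`: the blocks are `{i, (i+1)'}`, `{i+1, i'}` and `{j, j'}` for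
the other `j`. -/
noncomputable def s (n i : ℕ) : PartitionAlgebra n :=
  diag (Setoid.ker (Sum.elim (fun j => (j : ℕ) + 1) (fun j => Equiv.swap i (i + 1) ((j : ℕ) + 1)) :
    Vertex n → ℕ))

/-- `p_i ∈ 𝒜_n(z)`, for `1 ≤ i ≤ n`: the blocks are `{i}`, `{i'}` and `{j, j'}` for the
other `j`. -/
noncomputable def p (n i : ℕ) : PartitionAlgebra n :=
  diag (Setoid.ker (Sum.elim (fun j => ((j : ℕ) + 1, false))
    (fun j => ((j : ℕ) + 1, decide ((j : ℕ) + 1 = i))) : Vertex n → ℕ × Bool))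

/-- `pHalf n i` is `p_{i+1/2} ∈ 𝒜_n(z)`, for `1 ≤ i ≤ n - 1`: the blocks are `{i, i+1, i', (i+1)'}`
and `{j, j'}` for the other `j`. -/
noncomputable def pHalf (n i : ℕ) : PartitionAlgebra n :=
  diag (Setoid.ker (Sum.elim (fun j => if (j : ℕ) + 1 = i + 1 then i else (j : ℕ) + 1)
    (fun j => if (j : ℕ) + 1 = i + 1 then i else (j : ℕ) + 1) : Vertex n → ℕ))

/-! The Jucys--Murphy elements and the elements `σ`, formed in `𝒜_n(z)`. The recursions involve only
generators of `𝒜_i(z)` (for `L_i` and `σ_i`) or of `𝒜_{i+1}(z)` (for `L_{i+1/2}` and `σ_{i+1/2}`);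
the definitions are meant for `i ≤ n` and `i + 1 ≤ n` respectively, where the values are the images
under the inclusions `𝒜_1(z) ⊆ 𝒜_2(z) ⊆ ⋯ ⊆ 𝒜_n(z)`, which add vertical strands on the right and
respect the names of the generators. -/

mutual

/-- `L n i` is `L_i ∈ 𝒜_n(z)`, for `i ≤ n`; the last clause defines `L_{i+1}` for `i = m + 1`. -/
noncomputable def L (n : ℕ) : ℕ → PartitionAlgebra n
  | 0 => 0
  | 1 => p n 1
  | m + 2 =>
    - s n (m + 1) * L n (m + 1) * pHalf n (m + 1) - pHalf n (m + 1) * L n (m + 1) * s n (m + 1)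
      + pHalf n (m + 1) * L n (m + 1) * p n (m + 2) * pHalf n (m + 1)
      + s n (m + 1) * L n (m + 1) * s n (m + 1) + sigma n (m + 2)
termination_by i => (i, 1)

/-- `sigma n i` is `σ_i ∈ 𝒜_n(z)`, for `1 ≤ i ≤ n`; the value at `i = 0` is not used. The
last clause defines `σ_{i+1}` for `i = m + 2`. -/
noncomputable def sigma (n : ℕ) : ℕ → PartitionAlgebra n
  | 0 => 1
  | 1 => 1
  | 2 => s n 1
  | m + 3 =>
    s n (m + 1) * s n (m + 2) * sigma n (m + 2) * s n (m + 2) * s n (m + 1)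
      + s n (m + 2) * pHalf n (m + 1) * L n (m + 1) * s n (m + 2) * pHalf n (m + 1) * s n (m + 2)
      + pHalf n (m + 1) * L n (m + 1) * s n (m + 2) * pHalf n (m + 1)
      - s n (m + 2) * pHalf n (m + 1) * L n (m + 1) * s n (m + 1) * pHalf n (m + 2)
        * p n (m + 2) * pHalf n (m + 1)
      - pHalf n (m + 1) * p n (m + 2) * pHalf n (m + 2) * s n (m + 1) * L n (m + 1)
        * pHalf n (m + 1) * s n (m + 2)
termination_by i => (i, 0)

end

/-- `sigmaHalf n i` is `σ_{i+1/2} ∈ 𝒜_n(z)`, for `i + 1 ≤ n`; in the last clause `i = m + 2`. -/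
noncomputable def sigmaHalf (n : ℕ) : ℕ → PartitionAlgebra n
  | 0 => 1
  | 1 => 1
  | m + 2 =>
    s n (m + 1) * s n (m + 2) * sigmaHalf n (m + 1) * s n (m + 2) * s n (m + 1)
      + pHalf n (m + 1) * L n (m + 1) * s n (m + 2) * pHalf n (m + 1) * s n (m + 2)
      + s n (m + 2) * pHalf n (m + 1) * L n (m + 1) * s n (m + 2) * pHalf n (m + 1)
      - pHalf n (m + 1) * L n (m + 1) * s n (m + 1) * pHalf n (m + 2)
        * p n (m + 2) * pHalf n (m + 1)
      - s n (m + 2) * pHalf n (m + 1) * p n (m + 2) * pHalf n (m + 2) * s n (m + 1) * L n (m + 1)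
        * pHalf n (m + 1) * s n (m + 2)

/-- `LHalf n i` is `L_{i+1/2} ∈ 𝒜_n(z)`, for `i + 1 ≤ n`; in the last clause `i = m + 1`. -/
noncomputable def LHalf (n : ℕ) : ℕ → PartitionAlgebra n
  | 0 => 0
  | m + 1 =>
    - L n (m + 1) * pHalf n (m + 1) - pHalf n (m + 1) * L n (m + 1)
      + pHalf n (m + 1) * L n (m + 1) * p n (m + 1) * pHalf n (m + 1)
      + s n (m + 1) * LHalf n m * s n (m + 1) + sigmaHalf n (m + 1)

/-- `z_{k+1/2} = L_{1/2} + L_1 + L_{1+1/2} + ⋯ + L_k + L_{k+1/2}`, an element of `𝒜_{k+1}(z)`. -/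
noncomputable def zHalf (k : ℕ) : PartitionAlgebra (k + 1) :=
  ∑ i ∈ Finset.range (k + 1), LHalf (k + 1) i + ∑ i ∈ Finset.Icc 1 k, L (k + 1) i

/-- `z_{k+1} = L_{1/2} + L_1 + L_{1+1/2} + ⋯ + L_{k+1/2} + L_{k+1}`, an element of
`𝒜_{k+1}(z)`. -/
noncomputable def zSucc (k : ℕ) : PartitionAlgebra (k + 1) :=
  ∑ i ∈ Finset.range (k + 1), LHalf (k + 1) i + ∑ i ∈ Finset.Icc 1 (k + 1), L (k + 1) i

end PartitionAlg

-- Let `F` be a finite alphabet. With z specialised to |F|, a diagram acts on integer functions of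
-- words over `F` by a 0/1 matrix: the entry at two words is 1 when they label the diagram
-- constantly on its blocks. As |F| varies these representations are jointly faithful
-- (`eq_of_wordRep_eq`), and they also detect membership in the half algebra
-- (`mem_halfAlgebra_of_wordRep`).
--
-- On a word w = w_1 w_2 …, the recursions have closed solutions (`act_L_and_sigma`,
-- `act_sigmaHalf`, `act_LHalf`). L_i sums over all letters b the transposition (w_i b) applied to
-- the first i letters. L_{i+1/2} is |F| minus the sum over b of (w_{i+1} b) applied to the first i
-- letters. σ_{i+1} and σ_{i+1/2} apply (w_i w_{i+1}) to the first i+1 and the first i-1 letters.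
--
-- Let T_j be the sum over all ordered pairs (a, b) of the letter swap (a b) on the first j letters,
-- and T'_j the part with a and b different from w_{j+1}. Up to scalars, 2L_{j+1} = T_{j+1} - T'_j
-- and 2L_{j+1/2} = T'_j - T_j. The sums telescope, so 2z_{k+1} is T_{k+1} and 2z_{k+1/2} is T'_k,
-- up to scalars. On words of length k+1, T_{k+1} renames letters throughout the word and so
-- commutes with every diagram. T'_k does so with renamings that fix the last letter, and so
-- commutes with the diagrams that preserve that letter.

namespace PartitionAlg

-- The representation on words

section Representation

variable {k : ℕ} {F : Type}

/-- A labelling of the three rows of a stack by an arbitrary type. -/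
def rowLabel (a c b : Fin k → F) : Vertex3 k → F := Sum.elim a (Sum.elim c b)

theorem stack_le_ker_iff (d e : Diagram k) (a c b : Fin k → F) :
    stack d e ≤ Setoid.ker (rowLabel a c b) ↔
      d ≤ Setoid.ker (Sum.elim a c) ∧ e ≤ Setoid.ker (Sum.elim c b) := by
  have key : ∀ (r : Diagram k) (f : Vertex k → Vertex3 k) (g : Vertex3 k → F),
      r.map f ≤ Setoid.ker g ↔ r ≤ Setoid.ker (g ∘ f) := by
    intro r f g
    constructor
    · intro h x y hxy
      exact h (Setoid.le_comap_map hxy)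
    · intro h
      refine Setoid.eqvGen_le ?_
      rintro _ _ ⟨x, y, hxy, rfl, rfl⟩
      exact h hxy
  have h1 : rowLabel a c b ∘ upper k = Sum.elim a c := by
    funext v; rcases v with v | v <;> rfl
  have h2 : rowLabel a c b ∘ lower k = Sum.elim c b := by
    funext v; rcases v with v | v <;> rfl
  rw [stack, sup_le_iff, key, key, h1, h2]

/-- The values on the image of `m` are forced and all others are free. Applied to the components of
a stack, the free ones are the loops. -/
theorem card_label_extensions {X Q : Type} [Finite Q] (m : X → Q) (u : X → F)
    (h : ∀ x y, m x = m y → u x = u y) :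
    Nat.card {g : Q → F // ∀ x, g (m x) = u x} =
      Nat.card F ^ Nat.card {q : Q // ∀ x, m x ≠ q} := by
  classical
  have E : {g : Q → F // ∀ x, g (m x) = u x} ≃ ({q : Q // ∀ x, m x ≠ q} → F) :=
    { toFun := fun g q => g.1 q.1
      invFun := fun f => ⟨fun q => if hq : ∀ x, m x ≠ q then f ⟨q, hq⟩ else
          u (Classical.choose (not_forall_not.mp hq)), fun x => by
            have hq : ¬ ∀ y, m y ≠ m x := fun H => H x rfl
            simp only [dif_neg hq]
            exact h _ _ (Classical.choose_spec (not_forall_not.mp hq))⟩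
      left_inv := by
        rintro ⟨g, hg⟩
        ext q
        by_cases hq : ∀ x, m x ≠ q
        · simp only [dif_pos hq]
        · simp only [dif_neg hq]
          rw [← hg, Classical.choose_spec (not_forall_not.mp hq)]
      right_inv := by
        intro f
        funext q
        simp only [dif_pos q.2] }
  rw [Nat.card_congr E, Nat.card_fun]

open Classical in
/-- The matrix of a diagram acting on words of length `k` in the alphabet `F`. -/
noncomputable def wordMatrix (F : Type) (d : Diagram k) : Matrix (Fin k → F) (Fin k → F) ℤ :=
  fun a b => if d ≤ Setoid.ker (Sum.elim a b) then 1 else 0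

/-- An entry of the product counts labellings of the middle row compatible with both diagrams; each
loop contributes a free factor |F|. -/
theorem wordMatrix_mul [Fintype F] (d e : Diagram k) :
    wordMatrix F d * wordMatrix F e
      = (Fintype.card F : ℤ) ^ loops d e • wordMatrix F (comp d e) := by
  classical
  ext a b
  have hcount : (wordMatrix F d * wordMatrix F e) a b
      = Nat.card {c : Fin k → F // stack d e ≤ Setoid.ker (rowLabel a c b)} := by
    rw [Matrix.mul_apply, Nat.card_eq_fintype_card, Fintype.card_subtype, Finset.card_filter,
      Nat.cast_sum]
    refine Finset.sum_congr rfl fun c _ => ?_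
    rw [stack_le_ker_iff]
    by_cases h1 : d ≤ Setoid.ker (Sum.elim a c) <;>
      by_cases h2 : e ≤ Setoid.ker (Sum.elim c b) <;> simp [wordMatrix, h1, h2]
  let m : Vertex k → Quotient (stack d e) := fun v => Quotient.mk (stack d e) (outer k v)
  have E : {c : Fin k → F // stack d e ≤ Setoid.ker (rowLabel a c b)} ≃
      {g : Quotient (stack d e) → F // ∀ v, g (m v) = Sum.elim a b v} :=
    { toFun := fun c => ⟨Quotient.lift (rowLabel a c.1 b) fun x y hxy => c.2 hxy, fun v => by
        rcases v with v | v <;> rfl⟩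
      invFun := fun g => ⟨fun i => g.1 (Quotient.mk (stack d e) (Sum.inr (Sum.inl i))), by
        have : rowLabel a (fun i => g.1 (Quotient.mk (stack d e) (Sum.inr (Sum.inl i)))) b
            = fun x => g.1 (Quotient.mk (stack d e) x) := by
          funext x
          rcases x with x | x | x
          · exact (g.2 (Sum.inl x)).symm
          · rfl
          · exact (g.2 (Sum.inr x)).symm
        rw [this]
        intro x y hxy
        exact congrArg g.1 (Quotient.sound hxy)⟩
      left_inv := fun c => rfl
      right_inv := by
        rintro ⟨g, hg⟩
        ext q
        induction q using Quotient.inductionOn with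
        | h x =>
          rcases x with x | x | x
          · exact (hg (Sum.inl x)).symm
          · rfl
          · exact (hg (Sum.inr x)).symm }
  rw [hcount, Nat.card_congr E, Matrix.smul_apply, wordMatrix]
  by_cases h : comp d e ≤ Setoid.ker (Sum.elim a b)
  · rw [if_pos h, card_label_extensions m _ fun x y hxy =>
      h (show stack d e (outer k x) (outer k y) from Quotient.exact hxy)]
    simp [loops, m]
  · rw [if_neg h, smul_zero]
    have : IsEmpty {g : Quotient (stack d e) → F // ∀ v, g (m v) = Sum.elim a b v} := by
      refine ⟨fun g => h fun x y hxy => ?_⟩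
      have : m x = m y := Quotient.sound hxy
      rw [Setoid.ker_def, ← g.2 x, ← g.2 y, this]
    exact_mod_cast Nat.card_of_isEmpty

theorem wordMatrix_id [DecidableEq F] : wordMatrix F (idDiagram k) = 1 := by
  classical
  ext a b
  rw [wordMatrix, Matrix.one_apply]
  congr 1
  rw [eq_iff_iff]
  constructor
  · intro h
    funext i
    exact h (show idDiagram k (Sum.inl i) (Sum.inr i) from rfl)
  · rintro rfl x y hxy
    rcases x with x | x <;> rcases y with y | y <;> exact congrArg a hxy

/-- The additive map underlying `wordRep`. -/
noncomputable def wordRepAdd (k : ℕ) (F : Type) [Fintype F] :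
    PartitionAlgebra k →+ Matrix (Fin k → F) (Fin k → F) ℤ :=
  -- Only additive, since scalars change from ℤ[X] to ℤ by evaluation at |F|.
  Finsupp.liftAddHom (α := Diagram k) (M := ℤ[X]) fun d =>
    ((AddMonoidHom.flip (smulAddHom ℤ (Matrix (Fin k → F) (Fin k → F) ℤ))) (wordMatrix F d)).comp
      (Polynomial.evalRingHom (Fintype.card F : ℤ)).toAddMonoidHom

theorem smul_diag (r : ℤ[X]) (d : Diagram k) :
    r • diag d = (Finsupp.single d r : Diagram k →₀ ℤ[X]) :=
  Finsupp.smul_single_one d r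

theorem wordRepAdd_smul_diag [Fintype F] (r : ℤ[X]) (d : Diagram k) :
    wordRepAdd k F (r • diag d) = r.eval (Fintype.card F : ℤ) • wordMatrix F d := by
  rw [smul_diag]
  exact Finsupp.liftAddHom_apply_single (α := Diagram k) (M := ℤ[X]) _ d r

theorem induction_smul_diag {P : PartitionAlgebra k → Prop} (x : PartitionAlgebra k)
    (zero : P 0) (add : ∀ x y, P x → P y → P (x + y))
    (smul_diag : ∀ (r : ℤ[X]) (d : Diagram k), P (r • diag d)) :
    P x := by
  refine Finsupp.induction_linear (motive := P) x zero add fun d r => ?_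
  rw [← PartitionAlg.smul_diag]
  exact smul_diag r d

/-- The representation of the partition algebra at the parameter `|F|` on words in the
alphabet `F`. -/
noncomputable def wordRep (k : ℕ) (F : Type) [Fintype F] [DecidableEq F] :
    PartitionAlgebra k →+* Matrix (Fin k → F) (Fin k → F) ℤ :=
  { wordRepAdd k F with
    map_one' := by
      have h := wordRepAdd_smul_diag (F := F) 1 (idDiagram k)
      rw [one_smul, Polynomial.eval_one, one_smul, wordMatrix_id] at h
      exact h
    map_mul' := fun x y => by
      change wordRepAdd k F (x * y) = wordRepAdd k F x * wordRepAdd k F y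
      induction x using induction_smul_diag with
      | zero => rw [zero_mul, map_zero, zero_mul]
      | add x x' hx hx' => rw [add_mul, map_add, map_add, add_mul, hx, hx']
      | smul_diag r d =>
        induction y using induction_smul_diag with
        | zero => rw [mul_zero, map_zero, mul_zero]
        | add y y' hy hy' => rw [mul_add, map_add, map_add, mul_add, hy, hy']
        | smul_diag t e =>
          rw [smul_mul_smul_comm, diag_mul_diag, smul_smul, wordRepAdd_smul_diag,
            wordRepAdd_smul_diag, wordRepAdd_smul_diag, smul_mul_smul_comm, wordMatrix_mul,
            smul_smul, Polynomial.eval_mul, Polynomial.eval_mul, Polynomial.eval_pow,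
            Polynomial.eval_X] }

theorem wordRep_diag [Fintype F] [DecidableEq F] (d : Diagram k) :
    wordRep k F (diag d) = wordMatrix F d := by
  have h := wordRepAdd_smul_diag (F := F) 1 d
  rw [one_smul, Polynomial.eval_one, one_smul] at h
  exact h

-- Recovering coefficients from the representations

noncomputable instance (k : ℕ) : Fintype (Diagram k) :=
  @Fintype.ofFinite _ (Finite.of_injective (fun (d : Diagram k) v w => d v w)
    fun _ _ h => Setoid.ext fun v w => iff_of_eq (congrFun (congrFun h v) w))

/-- The coefficient of a diagram. -/
noncomputable def coeff (d : Diagram k) (x : PartitionAlgebra k) : ℤ[X] :=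
  (show Diagram k →₀ ℤ[X] from x) d

theorem coeff_ext {x y : PartitionAlgebra k} (h : ∀ d, coeff d x = coeff d y) : x = y :=
  Finsupp.ext (α := Diagram k) (M := ℤ[X]) h

-- The entry sums the coefficients of all refinements of the kernel of the labelling, a system
-- triangular for the refinement order.
open Classical in
theorem wordRep_apply [Fintype F] [DecidableEq F] (x : PartitionAlgebra k) (a b : Fin k → F) :
    wordRep k F x a b = ∑ d : Diagram k,
      if d ≤ Setoid.ker (Sum.elim a b) then (coeff d x).eval (Fintype.card F : ℤ) else 0 := by
  induction x using induction_smul_diag with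
  | zero =>
    rw [map_zero]
    exact (Finset.sum_eq_zero fun d _ => by
      rw [show coeff d (0 : PartitionAlgebra k) = 0 from rfl, Polynomial.eval_zero, ite_self]).symm
  | add x y hx hy =>
    rw [map_add, Matrix.add_apply, hx, hy, ← Finset.sum_add_distrib]
    refine Finset.sum_congr rfl fun d _ => ?_
    rw [show coeff d (x + y) = coeff d x + coeff d y from rfl]
    split_ifs <;> simp
  | smul_diag r e =>
    have h1 : wordRep k F (r • diag e) = _ := wordRepAdd_smul_diag r e
    have h2 : ∀ d, coeff d (r • diag e) = if e = d then r else 0 := fun d => by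
      rw [coeff, smul_diag]
      exact Finsupp.single_apply
    rw [h1, Matrix.smul_apply, wordMatrix, Finset.sum_eq_single e]
    · rw [h2, if_pos rfl]
      split_ifs <;> simp
    · intro d _ hd
      rw [h2, if_neg hd.symm, Polynomial.eval_zero, ite_self]
    · exact fun h => absurd (Finset.mem_univ e) h

/-- There are at most 2k blocks, so n letters suffice to label them distinctly. -/
theorem exists_ker_eq (d : Diagram k) {n : ℕ} (hn : 2 * k ≤ n) :
    ∃ a b : Fin k → Fin n, Setoid.ker (Sum.elim a b) = d := by
  have hcard : Nat.card (Quotient d) ≤ n := by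
    refine (Nat.card_le_card_of_surjective _ (Quotient.mk_surjective (s := d))).trans ?_
    simpa [two_mul] using hn
  have e := (Finite.equivFin (Quotient d)).toEmbedding.trans (Fin.castLEEmb hcard)
  refine ⟨fun i => e (Quotient.mk d (Sum.inl i)), fun i => e (Quotient.mk d (Sum.inr i)), ?_⟩
  have : (Sum.elim (fun i => e (Quotient.mk d (Sum.inl i))) fun i => e (Quotient.mk d (Sum.inr i)))
      = fun v => e (Quotient.mk d v) := by
    funext v; rcases v with v | v <;> rfl
  rw [this]
  ext v w
  rw [Setoid.ker_def, e.injective.eq_iff]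
  exact Quotient.eq

/-- Coefficients vanish on a lower set of diagrams if the matching matrix entries vanish in all
representations on words. -/
theorem coeff_eq_zero_of_wordRep {P : Diagram k → Prop} (hP : ∀ d e, d ≤ e → P e → P d)
    {x : PartitionAlgebra k}
    (hx : ∀ (n : ℕ) (a b : Fin k → Fin n), P (Setoid.ker (Sum.elim a b)) →
      wordRep k (Fin n) x a b = 0) (d : Diagram k) (hd : P d) : coeff d x = 0 := by
  classical
  have : WellFoundedLT (Diagram k) := Finite.to_wellFoundedLT
  induction d using WellFoundedLT.induction with
  | ind d ih =>
    -- For each n ≥ 2k take a labelling with kernel exactly `d`: strictly finer diagrams drop out of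
    -- the entry by induction, leaving the coefficient evaluated at n.
    refine Polynomial.eq_zero_of_infinite_isRoot _ (Set.Infinite.mono
      (s := (fun n : ℕ => (n : ℤ)) '' Set.Ici (2 * k)) ?_
      ((Set.Ici_infinite _).image Nat.cast_injective.injOn))
    rintro _ ⟨n, hn, rfl⟩
    obtain ⟨a, b, hab⟩ := exists_ker_eq d hn
    have h := hx n a b (hab ▸ hd)
    rw [wordRep_apply, hab, Finset.sum_eq_single d, if_pos le_rfl, Fintype.card_fin] at h
    · exact h
    · intro e _ hed
      split_ifs with hle
      · rw [ih e (lt_of_le_of_ne hle hed) (hP _ _ hle hd), Polynomial.eval_zero]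
      · rfl
    · exact fun h => absurd (Finset.mem_univ d) h

/-- A single alphabet would not do, since X - n acts as zero on words in n letters. -/
theorem eq_of_wordRep_eq {x y : PartitionAlgebra k}
    (h : ∀ n, wordRep k (Fin n) x = wordRep k (Fin n) y) : x = y := by
  refine coeff_ext fun d => sub_eq_zero.mp ?_
  refine coeff_eq_zero_of_wordRep (P := fun _ => True) (x := x - y) (fun _ _ _ h => h)
    (fun n a b _ => ?_) d trivial
  rw [map_sub, h, sub_self, Matrix.zero_apply]

/-- Diagrams that separate the two last vertices are closed under refinement, so their coefficients
are determined by the entries whose words have different last letters. -/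
theorem mem_halfAlgebra_of_wordRep {x : PartitionAlgebra (k + 1)}
    (h : ∀ (n : ℕ) (a b : Fin (k + 1) → Fin n), a (Fin.last k) ≠ b (Fin.last k) →
      wordRep (k + 1) (Fin n) x a b = 0) : x ∈ halfAlgebra k := by
  have hx : x = ∑ d : Diagram (k + 1), coeff d x • diag d := by
    have := Finsupp.univ_sum_single (show Diagram (k + 1) →₀ ℤ[X] from x)
    refine this.symm.trans (Finset.sum_congr rfl fun d _ => ?_)
    rw [smul_diag]
    rfl
  rw [hx]
  refine Subalgebra.sum_mem _ fun d _ => ?_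
  by_cases hd : d (Sum.inl (Fin.last k)) (Sum.inr (Fin.last k))
  · have hmem : diag d ∈ halfAlgebra k := Algebra.subset_adjoin ⟨d, hd, rfl⟩
    exact Subalgebra.smul_mem _ hmem _
  · rw [coeff_eq_zero_of_wordRep
      (P := fun d => ¬ d (Sum.inl (Fin.last k)) (Sum.inr (Fin.last k)))
      (fun d e hde he hd => he (hde hd)) (fun n a b => h n a b) d hd, zero_smul]
    exact Subalgebra.zero_mem _

end Representation
-- Action of the generators on functions of words
section Action

variable {N : ℕ} {F : Type} [Fintype F] [DecidableEq F]

/-- The action of the partition algebra on functions of words. -/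
noncomputable def act (x : PartitionAlgebra N) (f : (Fin N → F) → ℤ) : (Fin N → F) → ℤ :=
  (wordRep N F x).mulVec f

theorem act_add (x y : PartitionAlgebra N) (f : (Fin N → F) → ℤ) (w : Fin N → F) :
    act (x + y) f w = act x f w + act y f w := by
  rw [act, map_add, Matrix.add_mulVec]; rfl

theorem act_sub (x y : PartitionAlgebra N) (f : (Fin N → F) → ℤ) (w : Fin N → F) :
    act (x - y) f w = act x f w - act y f w := by
  rw [act, map_sub, Matrix.sub_mulVec]; rfl

theorem act_neg (x : PartitionAlgebra N) (f : (Fin N → F) → ℤ) (w : Fin N → F) :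
    act (-x) f w = -act x f w := by
  rw [act, map_neg, Matrix.neg_mulVec]; rfl

theorem act_zero (f : (Fin N → F) → ℤ) (w : Fin N → F) :
    act (0 : PartitionAlgebra N) f w = 0 := by
  rw [act, map_zero, Matrix.zero_mulVec]; rfl

theorem act_one (f : (Fin N → F) → ℤ) : act (1 : PartitionAlgebra N) f = f := by
  rw [act, map_one, Matrix.one_mulVec]

/-- As functions are transformed by evaluation at modified words, the leftmost factor modifies the
word first. -/
theorem act_mul (x y : PartitionAlgebra N) (f : (Fin N → F) → ℤ) :
    act (x * y) f = act x (act y f) := by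
  rw [act, map_mul, ← Matrix.mulVec_mulVec]; rfl

open Classical in
theorem act_diag (d : Diagram N) (f : (Fin N → F) → ℤ) (w : Fin N → F) :
    act (diag d) f w = ∑ u : Fin N → F, if d ≤ Setoid.ker (Sum.elim w u) then f u else 0 := by
  rw [act, wordRep_diag]
  refine Finset.sum_congr rfl fun u _ => ?_
  change wordMatrix F d w u * f u = _
  rw [wordMatrix, ite_mul, one_mul, zero_mul]

theorem act_s {i : ℕ} (hi : i + 1 < N) (f : (Fin N → F) → ℤ) (w : Fin N → F) :
    act (s N (i + 1)) f w
      = f (w ∘ Equiv.swap (⟨i, by omega⟩ : Fin N) ⟨i + 1, hi⟩) := by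
  classical
  have hsw : ∀ j : Fin N, ((Equiv.swap (⟨i, by omega⟩ : Fin N) ⟨i + 1, hi⟩ j : Fin N) : ℕ) + 1
      = Equiv.swap (i + 1) (i + 1 + 1) ((j : ℕ) + 1) := by
    intro j
    simp only [Equiv.swap_apply_def, Fin.ext_iff]
    split_ifs <;> simp_all
  rw [s, act_diag, Finset.sum_eq_single (w ∘ Equiv.swap (⟨i, by omega⟩ : Fin N) ⟨i + 1, hi⟩)]
  · rw [if_pos]
    have hw : Sum.elim w (w ∘ Equiv.swap (⟨i, by omega⟩ : Fin N) ⟨i + 1, hi⟩) =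
        w ∘ Sum.elim id (Equiv.swap (⟨i, by omega⟩ : Fin N) ⟨i + 1, hi⟩) := by
      funext v; rcases v with v | v <;> rfl
    rw [hw]
    intro v v' hv
    refine congrArg w (Fin.ext (Nat.succ_injective ?_))
    rw [Setoid.ker_def] at hv
    rcases v with v | v <;> rcases v' with v' | v' <;>
      simpa only [Sum.elim_inl, Sum.elim_inr, id, Nat.succ_eq_add_one, hsw] using hv
  · intro u _ hu
    refine if_neg fun h => hu (funext fun j => ?_)
    refine (h (x := Sum.inl (Equiv.swap (⟨i, by omega⟩ : Fin N) ⟨i + 1, hi⟩ j))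
      (y := Sum.inr j) ?_).symm
    exact hsw j
  · exact fun h => absurd (Finset.mem_univ _) h

theorem act_p {i : ℕ} (hi : i < N) (f : (Fin N → F) → ℤ) (w : Fin N → F) :
    act (p N (i + 1)) f w = ∑ b : F, f (Function.update w ⟨i, hi⟩ b) := by
  classical
  rw [p, act_diag, ← Finset.sum_filter]
  symm
  refine Finset.sum_bij (fun b _ => Function.update w ⟨i, hi⟩ b) ?_ ?_ ?_ ?_
  · intro b _
    rw [Finset.mem_filter]
    refine ⟨Finset.mem_univ _, ?_⟩
    intro v v' hv
    rw [Setoid.ker_def] at hv ⊢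
    rcases v with v | v <;> rcases v' with v' | v' <;>
      simp only [Sum.elim_inl, Sum.elim_inr, Prod.mk.injEq, Nat.add_right_cancel_iff, and_true,
        ← Fin.ext_iff] at hv ⊢
    · rw [hv]
    · obtain ⟨rfl, hv⟩ := hv
      rw [Function.update_of_ne]
      rintro rfl
      simp at hv
    · obtain ⟨rfl, hv⟩ := hv
      rw [Function.update_of_ne]
      rintro rfl
      simp at hv
    · rw [hv.1]
  · intro b _ c _ h
    simpa using congrFun h ⟨i, hi⟩
  · intro u hu
    rw [Finset.mem_filter] at hu
    refine ⟨u ⟨i, hi⟩, Finset.mem_univ _, funext fun j => ?_⟩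
    by_cases hj : j = ⟨i, hi⟩
    · rw [hj, Function.update_self]
    · rw [Function.update_of_ne hj]
      refine hu.2 (x := Sum.inl j) (y := Sum.inr j) ?_
      have : ¬ (j : ℕ) = i := fun h => hj (Fin.ext h)
      simp [Setoid.ker_def, this]
  · exact fun _ _ => rfl

theorem act_pHalf {i : ℕ} (hi : i + 1 < N) (f : (Fin N → F) → ℤ) (w : Fin N → F) :
    act (pHalf N (i + 1)) f w = if w ⟨i, by omega⟩ = w ⟨i + 1, hi⟩ then f w else 0 := by
  classical
  rw [pHalf, act_diag, Finset.sum_eq_single w]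
  · congr 1
    rw [eq_iff_iff]
    constructor
    · intro h
      exact h (x := Sum.inl ⟨i, by omega⟩) (y := Sum.inl ⟨i + 1, hi⟩) (by simp [Setoid.ker_def])
    · intro hw
      have key : ∀ j j' : Fin N, (if (j : ℕ) + 1 = i + 1 + 1 then i + 1 else (j : ℕ) + 1)
          = (if (j' : ℕ) + 1 = i + 1 + 1 then i + 1 else (j' : ℕ) + 1) → w j = w j' := by
        intro j j' h
        have e : ∀ (l : Fin N) (m : ℕ) (hm : m < N), (l : ℕ) = m → w l = w ⟨m, hm⟩ := by
          rintro l _ _ rfl; rfl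
        split_ifs at h with h1 h2 h2
        · exact congrArg w (Fin.ext (by omega))
        · rw [e j (i + 1) hi (by omega), e j' i (by omega) (by omega), hw]
        · rw [e j' (i + 1) hi (by omega), e j i (by omega) (by omega), hw]
        · exact congrArg w (Fin.ext (by omega))
      intro v v' hv
      rcases v with v | v <;> rcases v' with v' | v' <;> exact key _ _ hv
  · intro u _ hu
    refine if_neg fun h => hu (funext fun j => ?_)
    exact (h (x := Sum.inl j) (y := Sum.inr j) rfl).symm
  · exact fun h => absurd (Finset.mem_univ _) h

/-- Apply `g` to the first `m` letters of a word. -/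
def mapPrefix (m : ℕ) (g : F → F) (w : Fin N → F) : Fin N → F :=
  fun j => if (j : ℕ) < m then g (w j) else w j

end Action
-- Solving the recursions for the Jucys–Murphy elements
section Recursion

variable {N : ℕ} {F : Type}

/-- The equivalences handed to `h` let `simp` identify the prefix conditions with bounds m, m+1 and
m+2 away from the two special positions. -/
theorem word_ext_two {m : ℕ} (hm : m + 1 < N) {u v : Fin N → F}
    (h0 : u ⟨m, by omega⟩ = v ⟨m, by omega⟩) (h1 : u ⟨m + 1, hm⟩ = v ⟨m + 1, hm⟩)
    (h : ∀ j : Fin N, j ≠ ⟨m, by omega⟩ → j ≠ ⟨m + 1, hm⟩ → ((j : ℕ) < m + 1 ↔ (j : ℕ) < m) →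
      ((j : ℕ) < m + 2 ↔ (j : ℕ) < m) → u j = v j) : u = v := by
  funext j
  by_cases hj0 : j = ⟨m, by omega⟩
  · rw [hj0, h0]
  by_cases hj1 : j = ⟨m + 1, hm⟩
  · rw [hj1, h1]
  have h0' : ¬ (j : ℕ) = m := fun h => hj0 (Fin.ext h)
  have h1' : ¬ (j : ℕ) = m + 1 := fun h => hj1 (Fin.ext h)
  exact h j hj0 hj1 (by omega) (by omega)

theorem word_ext_three {m : ℕ} (hm : m + 2 < N) {u v : Fin N → F}
    (h0 : u ⟨m, by omega⟩ = v ⟨m, by omega⟩) (h1 : u ⟨m + 1, by omega⟩ = v ⟨m + 1, by omega⟩)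
    (h2 : u ⟨m + 2, hm⟩ = v ⟨m + 2, hm⟩)
    (h : ∀ j : Fin N, j ≠ ⟨m, by omega⟩ → j ≠ ⟨m + 1, by omega⟩ → j ≠ ⟨m + 2, hm⟩ →
      ((j : ℕ) < m + 1 ↔ (j : ℕ) < m) → ((j : ℕ) < m + 2 ↔ (j : ℕ) < m) →
      ((j : ℕ) < m + 3 ↔ (j : ℕ) < m) → u j = v j) : u = v :=
  word_ext_two (show m + 1 < N by omega) h0 h1 fun j hj0 hj1 hj2 hj3 => by
    by_cases hj : j = ⟨m + 2, hm⟩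
    · rw [hj, h2]
    have h' : ¬ (j : ℕ) = m + 2 := fun h => hj (Fin.ext h)
    exact h j hj0 hj1 hj hj2 hj3 (by omega)

theorem mapPrefix_zero (g : F → F) (w : Fin N → F) : mapPrefix 0 g w = w := by
  funext j
  simp [mapPrefix]

variable [Fintype F] [DecidableEq F]

theorem act_L_succ {m : ℕ} (hm : m + 1 < N)
    (hL : ∀ (f : (Fin N → F) → ℤ) (w : Fin N → F), act (L N (m + 1)) f w
      = ∑ b, f (mapPrefix (m + 1) (Equiv.swap (w ⟨m, by omega⟩) b) w))
    (hσ : ∀ (f : (Fin N → F) → ℤ) (w : Fin N → F), act (sigma N (m + 2)) f w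
      = f (mapPrefix (m + 2) (Equiv.swap (w ⟨m, by omega⟩) (w ⟨m + 1, hm⟩)) w))
    (f : (Fin N → F) → ℤ) (w : Fin N → F) : act (L N (m + 2)) f w
      = ∑ b, f (mapPrefix (m + 2) (Equiv.swap (w ⟨m + 1, hm⟩) b) w) := by
  have hp := fun f w => act_p (F := F) hm f w
  rw [L]
  simp only [act_add, act_sub, act_mul, neg_mul, act_neg, hL, hσ, act_s hm, act_pHalf hm, hp]
  simp [mapPrefix]
  generalize hx : w ⟨m, by omega⟩ = x
  generalize hy : w ⟨m + 1, hm⟩ = y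
  set π : Fin N ≃ Fin N := Equiv.swap ⟨m, by omega⟩ ⟨m + 1, hm⟩ with hπ
  have hother : ∀ j : Fin N, j ≠ ⟨m, by omega⟩ → j ≠ ⟨m + 1, hm⟩ → π j = j :=
    fun j h0 h1 => Equiv.swap_apply_of_ne_of_ne h0 h1
  -- If x = y, the third term is the answer; the first cancels against `sigma`, the second against
  -- the conjugate of `L`.
  by_cases hxy : x = y
  · subst hxy
    have e1 : mapPrefix (m + 1) (Equiv.swap x x) (w ∘ π) = w :=
      word_ext_two hm (by simp [mapPrefix, hπ, hx, hy]) (by simp [mapPrefix, hπ, hx, hy])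
        fun j h0 h1 h2 h3 => by simp [mapPrefix, hother j h0 h1]
    have e2 : mapPrefix (m + 2) (Equiv.swap x x) w = w := by
      funext j; simp [mapPrefix]
    have e3 : ∀ b, mapPrefix (m + 1) (Equiv.swap x b) (w ∘ π) ∘ π
        = mapPrefix (m + 1) (Equiv.swap x b) w ∘ π := fun b =>
      word_ext_two hm (by simp [mapPrefix, hπ, hx, hy]) (by simp [mapPrefix, hπ, hx, hy])
        fun j h0 h1 h2 h3 => by simp [mapPrefix, hother j h0 h1]
    have e4 : ∀ b, Function.update (mapPrefix (m + 1) (Equiv.swap x b) w) ⟨m + 1, hm⟩ b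
        = mapPrefix (m + 2) (Equiv.swap x b) w := fun b =>
      word_ext_two hm (by simp [mapPrefix, hx]) (by simp [mapPrefix, hy])
        fun j h0 h1 h2 h3 => by simp [mapPrefix, Function.update_of_ne h1, h2, h3]
    simp only [e1, e2, e3, e4, if_true]
    ring
  -- If x ≠ y, the conjugate of `L` leaves position m alone, which is wrong only for b = x. The
  -- first term of the recursion removes that summand and `sigma` supplies the right one.
  · have e : ∀ b, f (mapPrefix (m + 2) (Equiv.swap y b) w)
        = f (mapPrefix (m + 1) (Equiv.swap y b) (w ∘ π) ∘ π)
          + if x = b then f (mapPrefix (m + 2) (Equiv.swap x y) w)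
            - f (mapPrefix (m + 1) (Equiv.swap y x) (w ∘ π)) else 0 := by
      intro b
      split_ifs with hb
      · subst hb
        have e1 : mapPrefix (m + 1) (Equiv.swap y x) (w ∘ π) ∘ π
            = mapPrefix (m + 1) (Equiv.swap y x) (w ∘ π) :=
          word_ext_two hm (by simp [mapPrefix, hπ, hx, hy]) (by simp [mapPrefix, hπ, hx, hy])
            fun j h0 h1 h2 h3 => by simp [mapPrefix, hother j h0 h1]
        rw [e1, Equiv.swap_comm x y]
        ring
      · rw [add_zero]
        congr 1
        exact word_ext_two hm
          (by simp [mapPrefix, hπ, hx, Equiv.swap_apply_of_ne_of_ne hxy hb])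
          (by simp [mapPrefix, hπ, hy])
            fun j h0 h1 h2 h3 => by simp [mapPrefix, hother j h0 h1, h2, h3]
    simp only [e, Finset.sum_add_distrib, Finset.sum_ite_eq, Finset.mem_univ, if_true, if_neg hxy]
    ring

theorem act_LHalf_succ {m : ℕ} (hm : m + 1 < N)
    (hL : ∀ (f : (Fin N → F) → ℤ) (w : Fin N → F), act (L N (m + 1)) f w
      = ∑ b, f (mapPrefix (m + 1) (Equiv.swap (w ⟨m, by omega⟩) b) w))
    (hH : ∀ (f : (Fin N → F) → ℤ) (w : Fin N → F), act (LHalf N m) f w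
      = Fintype.card F * f w - ∑ b, f (mapPrefix m (Equiv.swap (w ⟨m, by omega⟩) b) w))
    (hσ : ∀ (f : (Fin N → F) → ℤ) (w : Fin N → F), act (sigmaHalf N (m + 1)) f w
      = f (mapPrefix m (Equiv.swap (w ⟨m, by omega⟩) (w ⟨m + 1, hm⟩)) w))
    (f : (Fin N → F) → ℤ) (w : Fin N → F) : act (LHalf N (m + 1)) f w
      = Fintype.card F * f w - ∑ b, f (mapPrefix (m + 1) (Equiv.swap (w ⟨m + 1, hm⟩) b) w) := by
  have hp := fun f w => act_p (F := F) (show m < N by omega) f w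
  rw [LHalf]
  simp only [act_add, act_sub, act_mul, neg_mul, act_neg, hL, hσ, hH, act_s hm, act_pHalf hm, hp]
  simp [mapPrefix]
  generalize hx : w ⟨m, by omega⟩ = x
  generalize hy : w ⟨m + 1, hm⟩ = y
  set π : Fin N ≃ Fin N := Equiv.swap ⟨m, by omega⟩ ⟨m + 1, hm⟩ with hπ
  have hother : ∀ j : Fin N, j ≠ ⟨m, by omega⟩ → j ≠ ⟨m + 1, hm⟩ → π j = j :=
    fun j h0 h1 => Equiv.swap_apply_of_ne_of_ne h0 h1
  have e0 : (w ∘ π) ∘ π = w := by funext j; simp [hπ]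
  have e1 : ∀ b, mapPrefix m (Equiv.swap y b) (w ∘ π) ∘ π = mapPrefix m (Equiv.swap y b) w :=
    fun b => word_ext_two hm (by simp [mapPrefix, hπ]) (by simp [mapPrefix, hπ])
      fun j h0 h1 h2 h3 => by simp [mapPrefix, hother j h0 h1]
  -- If x = y, the second term gives the required sum, the third cancels the sum in the conjugate of
  -- `LHalf`, and the first cancels `sigmaHalf`.
  by_cases hxy : x = y
  · subst hxy
    have e2 : ∀ m, mapPrefix m (Equiv.swap x x) w = w := fun m => by
      funext j; simp [mapPrefix]
    have e3 : ∀ b, Function.update (mapPrefix (m + 1) (Equiv.swap x b) w) ⟨m, by omega⟩ x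
        = mapPrefix m (Equiv.swap x b) w := fun b =>
      word_ext_two hm (by simp [mapPrefix, hx]) (by simp [mapPrefix])
        fun j h0 h1 h2 h3 => by simp [mapPrefix, Function.update_of_ne h0, h2]
    simp only [e0, e1, e2, e3, if_true]
    ring
  -- Again position m matters only for b = x, where the first term and `sigmaHalf` correct the
  -- summand.
  · have e : ∀ b, f (mapPrefix (m + 1) (Equiv.swap y b) w)
        = f (mapPrefix m (Equiv.swap y b) w)
          + if x = b then f (mapPrefix (m + 1) (Equiv.swap x y) w)
            - f (mapPrefix m (Equiv.swap x y) w) else 0 := by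
      intro b
      split_ifs with hb
      · subst hb
        rw [Equiv.swap_comm x y]
        ring
      · rw [add_zero]
        congr 1
        exact word_ext_two hm
          (by simp [mapPrefix, hx, Equiv.swap_apply_of_ne_of_ne hxy hb]) (by simp [mapPrefix])
            fun j h0 h1 h2 h3 => by simp [mapPrefix, h2]
    simp only [e, e0, e1, Finset.sum_add_distrib, Finset.sum_ite_eq, Finset.mem_univ, if_true,
      if_neg hxy]
    ring

/-- The conjugate of the previous σ applies (y z) to the right letters except x at position m, so it
is wrong only if x is y or z. For each of these coincidences one positive term gives the right value
and one negative term removes the conjugate. -/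
theorem act_sigma_succ {m : ℕ} (hm : m + 2 < N)
    (hL : ∀ (f : (Fin N → F) → ℤ) (w : Fin N → F), act (L N (m + 1)) f w
      = ∑ b, f (mapPrefix (m + 1) (Equiv.swap (w ⟨m, by omega⟩) b) w))
    (hσ : ∀ (f : (Fin N → F) → ℤ) (w : Fin N → F), act (sigma N (m + 2)) f w
      = f (mapPrefix (m + 2) (Equiv.swap (w ⟨m, by omega⟩) (w ⟨m + 1, by omega⟩)) w))
    (f : (Fin N → F) → ℤ) (w : Fin N → F) : act (sigma N (m + 3)) f w
      = f (mapPrefix (m + 3) (Equiv.swap (w ⟨m + 1, by omega⟩) (w ⟨m + 2, hm⟩)) w) := by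
  have hm1 : m + 1 < N := by omega
  have hp := fun f w => act_p (F := F) hm1 f w
  have hs := fun f w => act_s (F := F) hm f w
  have hh := fun f w => act_pHalf (F := F) hm f w
  rw [sigma]
  simp only [act_add, act_sub, act_mul, hL, hσ, act_s hm1, act_pHalf hm1, hp, hs, hh]
  set π : Fin N ≃ Fin N := Equiv.swap ⟨m, by omega⟩ ⟨m + 1, by omega⟩
  set τ : Fin N ≃ Fin N := Equiv.swap ⟨m + 1, by omega⟩ ⟨m + 2, hm⟩
  have π0 : π ⟨m, by omega⟩ = ⟨m + 1, by omega⟩ := Equiv.swap_apply_left _ _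
  have π1 : π ⟨m + 1, by omega⟩ = ⟨m, by omega⟩ := Equiv.swap_apply_right _ _
  have π2 : π ⟨m + 2, by omega⟩ = ⟨m + 2, by omega⟩ :=
    Equiv.swap_apply_of_ne_of_ne (by simp) (by simp)
  have τ0 : τ ⟨m, by omega⟩ = ⟨m, by omega⟩ :=
    Equiv.swap_apply_of_ne_of_ne (by simp) (by simp)
  have τ1 : τ ⟨m + 1, by omega⟩ = ⟨m + 2, by omega⟩ := Equiv.swap_apply_left _ _
  have τ2 : τ ⟨m + 2, by omega⟩ = ⟨m + 1, by omega⟩ := Equiv.swap_apply_right _ _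
  simp [mapPrefix, π0, π1, π2, τ0, τ1, τ2]
  generalize hx : w ⟨m, by omega⟩ = x
  generalize hy : w ⟨m + 1, by omega⟩ = y
  generalize hz : w ⟨m + 2, hm⟩ = z
  have hπj : ∀ j : Fin N, j ≠ ⟨m, by omega⟩ → j ≠ ⟨m + 1, by omega⟩ → π j = j :=
    fun j h0 h1 => Equiv.swap_apply_of_ne_of_ne h0 h1
  have hτj : ∀ j : Fin N, j ≠ ⟨m + 1, by omega⟩ → j ≠ ⟨m + 2, hm⟩ → τ j = j :=
    fun j h0 h1 => Equiv.swap_apply_of_ne_of_ne h0 h1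
  -- From here `simp` uses the permutations only through the values recorded above.
  clear_value π τ
  clear hL hσ hp hs hh
  have e1 : x ≠ y → x ≠ z →
      (mapPrefix (m + 2) (Equiv.swap y z) ((w ∘ π) ∘ τ) ∘ τ) ∘ π
        = mapPrefix (m + 3) (Equiv.swap y z) w := fun hxy hxz => by
    have hyz := Equiv.swap_apply_of_ne_of_ne hxy hxz
    refine word_ext_three hm ?_ ?_ ?_ fun j j0 j1 j2 k1 k2 k3 => ?_ <;> simp [mapPrefix, *]
  have e2 : x = z → (mapPrefix (m + 1) (Equiv.swap x y) (w ∘ τ) ∘ τ) ∘ τ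
      = mapPrefix (m + 3) (Equiv.swap y z) w := by
    rintro rfl
    rw [Equiv.swap_comm y x]
    refine word_ext_three hm ?_ ?_ ?_ fun j j0 j1 j2 k1 k2 k3 => ?_ <;> simp [mapPrefix, *]
  have e3 : x = y → mapPrefix (m + 1) (Equiv.swap x z) w ∘ τ
      = mapPrefix (m + 3) (Equiv.swap y z) w := by
    rintro rfl
    refine word_ext_three hm ?_ ?_ ?_ fun j j0 j1 j2 k1 k2 k3 => ?_ <;> simp [mapPrefix, *]
  have e4 : x = z → Function.update (mapPrefix (m + 1) (Equiv.swap x y) (w ∘ τ) ∘ π)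
        ⟨m + 1, hm1⟩ z
      = (mapPrefix (m + 2) (Equiv.swap y z) ((w ∘ π) ∘ τ) ∘ τ) ∘ π := by
    rintro rfl
    rw [Equiv.swap_comm y x]
    refine word_ext_three hm ?_ ?_ ?_ fun j j0 j1 j2 k1 k2 k3 => ?_ <;> simp [mapPrefix, *]
  have e5 : x = y → mapPrefix (m + 1) (Equiv.swap z x) (Function.update w ⟨m + 1, hm1⟩ z ∘ π) ∘ τ
      = (mapPrefix (m + 2) (Equiv.swap y z) ((w ∘ π) ∘ τ) ∘ τ) ∘ π := by
    rintro rfl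
    rw [Equiv.swap_comm z x]
    refine word_ext_three hm ?_ ?_ ?_ fun j j0 j1 j2 k1 k2 k3 => ?_ <;> simp [mapPrefix, *]
  by_cases hxy : x = y
  · rw [if_pos hxy, if_pos hxy, e3 hxy, e5 hxy]
    by_cases hxz : x = z
    · rw [if_pos hxz, if_pos hxz, e2 hxz, e4 hxz]
      -- With x = y = z both corrections apply; the two values agree because the swap is trivial.
      have e6 : (mapPrefix (m + 2) (Equiv.swap y z) ((w ∘ π) ∘ τ) ∘ τ) ∘ π
          = mapPrefix (m + 3) (Equiv.swap y z) w := by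
        subst hxy hxz
        refine word_ext_three hm ?_ ?_ ?_ fun j j0 j1 j2 k1 k2 k3 => ?_ <;> simp [mapPrefix, *]
      rw [e6]
      ring
    · rw [if_neg hxz, if_neg hxz]
      ring
  · rw [if_neg hxy, if_neg hxy]
    by_cases hxz : x = z
    · rw [if_pos hxz, if_pos hxz, e2 hxz, e4 hxz]
      ring
    · rw [if_neg hxz, if_neg hxz, e1 hxy hxz]
      ring

/-- The mechanism is that of `act_sigma_succ`: the conjugate omits only position m, which matters
only if x is y or z. -/
theorem act_sigmaHalf_succ {m : ℕ} (hm : m + 2 < N)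
    (hL : ∀ (f : (Fin N → F) → ℤ) (w : Fin N → F), act (L N (m + 1)) f w
      = ∑ b, f (mapPrefix (m + 1) (Equiv.swap (w ⟨m, by omega⟩) b) w))
    (hσ : ∀ (f : (Fin N → F) → ℤ) (w : Fin N → F), act (sigmaHalf N (m + 1)) f w
      = f (mapPrefix m (Equiv.swap (w ⟨m, by omega⟩) (w ⟨m + 1, by omega⟩)) w))
    (f : (Fin N → F) → ℤ) (w : Fin N → F) : act (sigmaHalf N (m + 2)) f w
      = f (mapPrefix (m + 1) (Equiv.swap (w ⟨m + 1, by omega⟩) (w ⟨m + 2, hm⟩)) w) := by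
  have hm1 : m + 1 < N := by omega
  have hp := fun f w => act_p (F := F) hm1 f w
  have hs := fun f w => act_s (F := F) hm f w
  have hh := fun f w => act_pHalf (F := F) hm f w
  rw [sigmaHalf]
  simp only [act_add, act_sub, act_mul, hL, hσ, act_s hm1, act_pHalf hm1, hp, hs, hh]
  set π : Fin N ≃ Fin N := Equiv.swap ⟨m, by omega⟩ ⟨m + 1, by omega⟩
  set τ : Fin N ≃ Fin N := Equiv.swap ⟨m + 1, by omega⟩ ⟨m + 2, hm⟩
  have π0 : π ⟨m, by omega⟩ = ⟨m + 1, by omega⟩ := Equiv.swap_apply_left _ _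
  have π1 : π ⟨m + 1, by omega⟩ = ⟨m, by omega⟩ := Equiv.swap_apply_right _ _
  have π2 : π ⟨m + 2, by omega⟩ = ⟨m + 2, by omega⟩ :=
    Equiv.swap_apply_of_ne_of_ne (by simp) (by simp)
  have τ0 : τ ⟨m, by omega⟩ = ⟨m, by omega⟩ :=
    Equiv.swap_apply_of_ne_of_ne (by simp) (by simp)
  have τ1 : τ ⟨m + 1, by omega⟩ = ⟨m + 2, by omega⟩ := Equiv.swap_apply_left _ _
  have τ2 : τ ⟨m + 2, by omega⟩ = ⟨m + 1, by omega⟩ := Equiv.swap_apply_right _ _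
  simp [mapPrefix, π0, π1, π2, τ0, τ1, τ2]
  generalize hx : w ⟨m, by omega⟩ = x
  generalize hy : w ⟨m + 1, by omega⟩ = y
  generalize hz : w ⟨m + 2, hm⟩ = z
  have hπj : ∀ j : Fin N, j ≠ ⟨m, by omega⟩ → j ≠ ⟨m + 1, by omega⟩ → π j = j :=
    fun j h0 h1 => Equiv.swap_apply_of_ne_of_ne h0 h1
  have hτj : ∀ j : Fin N, j ≠ ⟨m + 1, by omega⟩ → j ≠ ⟨m + 2, hm⟩ → τ j = j :=
    fun j h0 h1 => Equiv.swap_apply_of_ne_of_ne h0 h1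
  clear_value π τ
  clear hL hσ hp hs hh
  have e1 : x ≠ y → x ≠ z →
      (mapPrefix m (Equiv.swap y z) ((w ∘ π) ∘ τ) ∘ τ) ∘ π
        = mapPrefix (m + 1) (Equiv.swap y z) w := fun hxy hxz => by
    have hyz := Equiv.swap_apply_of_ne_of_ne hxy hxz
    refine word_ext_three hm ?_ ?_ ?_ fun j j0 j1 j2 k1 k2 k3 => ?_ <;> simp [mapPrefix, *]
  have e2 : x = y → (mapPrefix (m + 1) (Equiv.swap x z) w ∘ τ) ∘ τ
      = mapPrefix (m + 1) (Equiv.swap y z) w := by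
    rintro rfl
    refine word_ext_three hm ?_ ?_ ?_ fun j j0 j1 j2 k1 k2 k3 => ?_ <;> simp [mapPrefix, *]
  have e3 : x = z → mapPrefix (m + 1) (Equiv.swap x y) (w ∘ τ) ∘ τ
      = mapPrefix (m + 1) (Equiv.swap y z) w := by
    rintro rfl
    rw [Equiv.swap_comm y x]
    refine word_ext_three hm ?_ ?_ ?_ fun j j0 j1 j2 k1 k2 k3 => ?_ <;> simp [mapPrefix, *]
  have e4 : x = y → Function.update (mapPrefix (m + 1) (Equiv.swap x z) w ∘ π) ⟨m + 1, hm1⟩ y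
      = (mapPrefix m (Equiv.swap y z) ((w ∘ π) ∘ τ) ∘ τ) ∘ π := by
    rintro rfl
    refine word_ext_three hm ?_ ?_ ?_ fun j j0 j1 j2 k1 k2 k3 => ?_ <;> simp [mapPrefix, *]
  have e5 : x = z →
      mapPrefix (m + 1) (Equiv.swap y x) (Function.update (w ∘ τ) ⟨m + 1, hm1⟩ y ∘ π) ∘ τ
      = (mapPrefix m (Equiv.swap y z) ((w ∘ π) ∘ τ) ∘ τ) ∘ π := by
    rintro rfl
    refine word_ext_three hm ?_ ?_ ?_ fun j j0 j1 j2 k1 k2 k3 => ?_ <;> simp [mapPrefix, *]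
  by_cases hxy : x = y
  · rw [if_pos hxy, if_pos hxy, e2 hxy, e4 hxy]
    by_cases hxz : x = z
    · rw [if_pos hxz, if_pos hxz, e3 hxz, e5 hxz]
      have e6 : (mapPrefix m (Equiv.swap y z) ((w ∘ π) ∘ τ) ∘ τ) ∘ π
          = mapPrefix (m + 1) (Equiv.swap y z) w := by
        subst hxy hxz
        refine word_ext_three hm ?_ ?_ ?_ fun j j0 j1 j2 k1 k2 k3 => ?_ <;> simp [mapPrefix, *]
      rw [e6]
      ring
    · rw [if_neg hxz, if_neg hxz]
      ring
  · rw [if_neg hxy, if_neg hxy]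
    by_cases hxz : x = z
    · rw [if_pos hxz, if_pos hxz, e3 hxz, e5 hxz]
      ring
    · rw [if_neg hxz, if_neg hxz, e1 hxy hxz]
      ring
-- The index shift fits the joint recursion: L_{m+2} needs L_{m+1} and σ_{m+2}, and so does σ_{m+3}.
theorem act_L_and_sigma (m : ℕ) :
    (∀ (hm : m < N) (f : (Fin N → F) → ℤ) (w : Fin N → F), act (L N (m + 1)) f w
      = ∑ b, f (mapPrefix (m + 1) (Equiv.swap (w ⟨m, hm⟩) b) w)) ∧
    (∀ (hm : m + 1 < N) (f : (Fin N → F) → ℤ) (w : Fin N → F), act (sigma N (m + 2)) f w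
      = f (mapPrefix (m + 2) (Equiv.swap (w ⟨m, by omega⟩) (w ⟨m + 1, hm⟩)) w)) := by
  induction m with
  | zero =>
    refine ⟨fun hm f w => ?_, fun hm f w => ?_⟩
    · rw [L, act_p hm]
      refine Finset.sum_congr rfl fun b _ => congrArg f (funext fun j => ?_)
      by_cases hj : j = ⟨0, hm⟩
      · subst hj
        simp [mapPrefix]
      · have hj' : ¬ (j : ℕ) = 0 := fun h => hj (Fin.ext h)
        simp [mapPrefix, Function.update_of_ne hj, hj']
    · rw [sigma, act_s hm]
      refine congrArg f (word_ext_two hm (by simp [mapPrefix]) (by simp [mapPrefix])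
        fun j h0 h1 h2 h3 => ?_)
      simp [mapPrefix, Equiv.swap_apply_of_ne_of_ne h0 h1, h3]
  | succ m ih =>
    refine ⟨fun hm => ?_, fun hm => ?_⟩
    · exact act_L_succ hm (ih.1 (by omega)) (ih.2 hm)
    · exact act_sigma_succ hm (ih.1 (by omega)) (ih.2 (by omega))

theorem act_L {m : ℕ} (hm : m < N) (f : (Fin N → F) → ℤ) (w : Fin N → F) :
    act (L N (m + 1)) f w = ∑ b, f (mapPrefix (m + 1) (Equiv.swap (w ⟨m, hm⟩) b) w) :=
  (act_L_and_sigma m).1 hm f w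

theorem act_sigmaHalf {m : ℕ} (hm : m + 1 < N) (f : (Fin N → F) → ℤ) (w : Fin N → F) :
    act (sigmaHalf N (m + 1)) f w
      = f (mapPrefix m (Equiv.swap (w ⟨m, by omega⟩) (w ⟨m + 1, hm⟩)) w) := by
  induction m generalizing f w with
  | zero => rw [sigmaHalf, act_one, mapPrefix_zero]
  | succ m ih => exact act_sigmaHalf_succ hm (act_L (by omega)) (ih (by omega)) f w

theorem act_LHalf {m : ℕ} (hm : m < N) (f : (Fin N → F) → ℤ) (w : Fin N → F) :
    act (LHalf N m) f w
      = Fintype.card F * f w - ∑ b, f (mapPrefix m (Equiv.swap (w ⟨m, hm⟩) b) w) := by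
  induction m generalizing f w with
  | zero => simp [LHalf, act_zero, mapPrefix_zero]
  | succ m ih => exact act_LHalf_succ hm (act_L (by omega)) (ih (by omega)) (act_sigmaHalf hm) f w

end Recursion
-- Telescoping into sums of letter transpositions
section Center

variable {N : ℕ} {F : Type}

theorem mapPrefix_self (g : F → F) (w : Fin N → F) : mapPrefix N g w = g ∘ w := by
  funext j
  simp [mapPrefix]

theorem mapPrefix_swap_self [DecidableEq F] (m : ℕ) (a : F) (w : Fin N → F) :
    mapPrefix m (Equiv.swap a a) w = w := by
  funext j
  simp [mapPrefix]

variable [Fintype F] [DecidableEq F]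

/-- The sum of all transpositions of letters, acting on the first `j` letters of a word. -/
def swapSum (j : ℕ) (f : (Fin N → F) → ℤ) (w : Fin N → F) : ℤ :=
  ∑ a, ∑ b, f (mapPrefix j (Equiv.swap a b) w)

/-- The sum of the transpositions that fix the letter at position `j`, acting on the letters
before that position. -/
def swapSumFixing (j : Fin N) (f : (Fin N → F) → ℤ) (w : Fin N → F) : ℤ :=
  ∑ a, ∑ b, if a ≠ w j ∧ b ≠ w j then f (mapPrefix j (Equiv.swap a b) w) else 0

/-- Inclusion–exclusion on the row and the column of `c`. -/
theorem sum_sum_ite_ne (G : F → F → ℤ) (hG : ∀ a b, G a b = G b a) (c : F) :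
    ∑ a, ∑ b, (if a ≠ c ∧ b ≠ c then G a b else 0)
      = ∑ a, ∑ b, G a b - 2 * ∑ b, G c b + G c c := by
  have h : ∀ a b, (if a ≠ c ∧ b ≠ c then G a b else 0)
      = G a b - (if c = a then G c b else 0) - (if c = b then G c a else 0)
        + if c = a then if c = b then G c c else 0 else 0 := by
    intro a b
    by_cases ha : c = a
    · subst ha
      by_cases hb : c = b <;> simp [hb]
    · by_cases hb : c = b
      · subst hb
        simp [ha, hG a c]
      · simp [ha, hb, Ne.symm ha, Ne.symm hb]
  simp only [h, Finset.sum_add_distrib, Finset.sum_sub_distrib, Finset.sum_ite_eq,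
    Finset.mem_univ, if_true, Finset.sum_ite_irrel, Finset.sum_const_zero]
  ring

theorem swapSumFixing_eq (j : Fin N) (f : (Fin N → F) → ℤ) (w : Fin N → F) :
    swapSumFixing j f w
      = swapSum j f w - 2 * ∑ b, f (mapPrefix j (Equiv.swap (w j) b) w) + f w := by
  rw [swapSumFixing, sum_sum_ite_ne (fun a b => f (mapPrefix j (Equiv.swap a b) w))
    (fun a b => by rw [Equiv.swap_comm]), mapPrefix_swap_self, swapSum]

/-- Swaps that fix the letter at position j act alike on prefixes of length j and j+1. Expanding the
same sum both ways links consecutive values of `swapSum`. -/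
theorem swapSumFixing_eq_succ (j : Fin N) (f : (Fin N → F) → ℤ) (w : Fin N → F) :
    swapSumFixing j f w
      = swapSum (j + 1) f w - 2 * ∑ b, f (mapPrefix (j + 1) (Equiv.swap (w j) b) w) + f w := by
  have h : swapSumFixing j f w
      = ∑ a, ∑ b, if a ≠ w j ∧ b ≠ w j then f (mapPrefix (j + 1) (Equiv.swap a b) w) else 0 := by
    refine Finset.sum_congr rfl fun a _ => Finset.sum_congr rfl fun b _ => ?_
    split_ifs with hab
    · refine congrArg f (funext fun i => ?_)
      by_cases hi : i = j
      · subst hi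
        simp [mapPrefix, Equiv.swap_apply_of_ne_of_ne hab.1.symm hab.2.symm]
      · have hi' : (i : ℕ) < j + 1 ↔ (i : ℕ) < j := by
          have : ¬ (i : ℕ) = j := fun h => hi (Fin.ext h)
          omega
        simp [mapPrefix, hi']
    · rfl
  rw [h, sum_sum_ite_ne (fun a b => f (mapPrefix (j + 1) (Equiv.swap a b) w))
    (fun a b => by rw [Equiv.swap_comm]), mapPrefix_swap_self, swapSum]

/-- The factor 2 arises because ordered pairs count each transposition twice. -/
theorem two_mul_act_L {j : ℕ} (hj : j < N) (f : (Fin N → F) → ℤ) (w : Fin N → F) :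
    2 * act (L N (j + 1)) f w = swapSum (j + 1) f w - swapSumFixing ⟨j, hj⟩ f w + f w := by
  rw [swapSumFixing_eq_succ, act_L hj]
  ring

theorem two_mul_act_LHalf {j : ℕ} (hj : j < N) (f : (Fin N → F) → ℤ) (w : Fin N → F) :
    2 * act (LHalf N j) f w
      = swapSumFixing ⟨j, hj⟩ f w - swapSum j f w + (2 * Fintype.card F - 1) * f w := by
  rw [swapSumFixing_eq, act_LHalf hj]
  ring

theorem act_sum_L_succ {j : ℕ} (hj : j < N)
    (h : ∃ c : ℤ, ∀ (f : (Fin N → F) → ℤ) (w : Fin N → F),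
      2 * act (∑ i ∈ Finset.range (j + 1), LHalf N i + ∑ i ∈ Finset.Icc 1 j, L N i) f w
        = swapSumFixing ⟨j, hj⟩ f w + c * f w) :
    ∃ c : ℤ, ∀ (f : (Fin N → F) → ℤ) (w : Fin N → F),
      2 * act (∑ i ∈ Finset.range (j + 1), LHalf N i + ∑ i ∈ Finset.Icc 1 (j + 1), L N i) f w
        = swapSum (j + 1) f w + c * f w := by
  obtain ⟨c, hc⟩ := h
  refine ⟨c + 1, fun f w => ?_⟩
  rw [Finset.sum_Icc_succ_top (by omega), ← add_assoc, act_add, mul_add, hc, two_mul_act_L hj]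
  ring

theorem act_sum_LHalf {j : ℕ} (hj : j < N) :
    ∃ c : ℤ, ∀ (f : (Fin N → F) → ℤ) (w : Fin N → F),
      2 * act (∑ i ∈ Finset.range (j + 1), LHalf N i + ∑ i ∈ Finset.Icc 1 j, L N i) f w
        = swapSumFixing ⟨j, hj⟩ f w + c * f w := by
  induction j with
  | zero =>
    -- On the empty prefix all |F|² swaps are trivial.
    refine ⟨(2 * Fintype.card F - 1) - Fintype.card F * Fintype.card F, fun f w => ?_⟩
    have h0 : swapSum 0 f w = Fintype.card F * Fintype.card F * f w := by
      simp [swapSum, mapPrefix_zero, mul_assoc]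
    rw [Finset.sum_range_one, Finset.Icc_eq_empty (by omega), Finset.sum_empty, add_zero,
      two_mul_act_LHalf hj, h0]
    ring
  | succ j ih =>
    obtain ⟨c, hc⟩ := act_sum_L_succ (by omega) (ih (by omega))
    refine ⟨c + (2 * Fintype.card F - 1), fun f w => ?_⟩
    rw [Finset.sum_range_succ, add_right_comm, act_add, mul_add, hc, two_mul_act_LHalf hj]
    ring

-- Commutation with diagrams and centrality

theorem act_add_right (x : PartitionAlgebra N) (f g : (Fin N → F) → ℤ) :
    act x (f + g) = act x f + act x g :=
  Matrix.mulVec_add _ _ _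

theorem act_smul_right (x : PartitionAlgebra N) (c : ℤ) (f : (Fin N → F) → ℤ) :
    act x (c • f) = c • act x f :=
  Matrix.mulVec_smul _ _ _

theorem act_sum_right {ι : Type} (t : Finset ι) (x : PartitionAlgebra N)
    (f : ι → (Fin N → F) → ℤ) : act x (∑ i ∈ t, f i) = ∑ i ∈ t, act x (f i) :=
  map_sum (wordRep N F x).mulVecLin f t

theorem wordRep_apply_eq_act (x : PartitionAlgebra N) (a b : Fin N → F) :
    wordRep N F x a b = act x (Pi.single b 1) a := by
  rw [act, Matrix.mulVec_single_one]
  rfl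

theorem eq_of_act_eq {x y : PartitionAlgebra N}
    (h : ∀ (n : ℕ) (f : (Fin N → Fin n) → ℤ) (w : Fin N → Fin n), act x f w = act y f w) :
    x = y :=
  eq_of_wordRep_eq fun n => by
    ext a b
    rw [wordRep_apply_eq_act, wordRep_apply_eq_act, h]

/-- Diagrams commute with permutations of the alphabet. -/
theorem act_diag_comp_perm (d : Diagram N) (g : Equiv.Perm F) (f : (Fin N → F) → ℤ)
    (w : Fin N → F) : act (diag d) (fun u => f (g ∘ u)) w = act (diag d) f (g ∘ w) := by
  classical
  rw [act_diag, act_diag]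
  refine Fintype.sum_equiv (Equiv.arrowCongr (Equiv.refl _) g) _ _ fun u => ?_
  have h : Sum.elim (g ∘ w) (g ∘ u) = g ∘ Sum.elim w u := Sum.comp_elim g w u |>.symm
  have hker : Setoid.ker (g ∘ Sum.elim w u) = Setoid.ker (Sum.elim w u) :=
    Setoid.ext fun v v' => g.injective.eq_iff
  change _ = if d ≤ Setoid.ker (Sum.elim (g ∘ w) (g ∘ u)) then f (g ∘ u) else 0
  rw [h, hker]

/-- A diagram joining i to i' preserves the letter at i, so only words with that letter contribute.
-/
theorem act_diag_congr (d : Diagram N) (i : Fin N) (hd : d (Sum.inl i) (Sum.inr i))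
    {f g : (Fin N → F) → ℤ} {w : Fin N → F} (h : ∀ u, u i = w i → f u = g u) :
    act (diag d) f w = act (diag d) g w := by
  classical
  rw [act_diag, act_diag]
  refine Finset.sum_congr rfl fun u _ => ?_
  split_ifs with hu
  · exact h u (hu hd).symm
  · rfl

theorem act_diag_swapSum (d : Diagram N) (f : (Fin N → F) → ℤ) (w : Fin N → F) :
    act (diag d) (swapSum N f) w = swapSum N (act (diag d) f) w := by
  have h : swapSum N f = ∑ a : F, ∑ b : F, fun u => f (Equiv.swap a b ∘ u) := by
    funext u
    simp [swapSum, mapPrefix_self]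
  rw [h, act_sum_right, Finset.sum_apply]
  refine Finset.sum_congr rfl fun a _ => ?_
  rw [act_sum_right, Finset.sum_apply]
  refine Finset.sum_congr rfl fun b _ => ?_
  rw [act_diag_comp_perm, mapPrefix_self]

theorem swapSumFixing_last {k : ℕ} (f : (Fin (k + 1) → F) → ℤ) (w : Fin (k + 1) → F) :
    swapSumFixing (Fin.last k) f w = ∑ a, ∑ b,
      (if a ≠ w (Fin.last k) ∧ b ≠ w (Fin.last k) then 1 else 0) * f (Equiv.swap a b ∘ w) := by
  refine Finset.sum_congr rfl fun a _ => Finset.sum_congr rfl fun b _ => ?_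
  split_ifs with hab
  · rw [one_mul]
    refine congrArg f (funext fun i => ?_)
    refine Fin.lastCases ?_ (fun i => ?_) i
    · simp [mapPrefix, Equiv.swap_apply_of_ne_of_ne hab.1.symm hab.2.symm]
    · simp [mapPrefix]
  · rw [zero_mul]

theorem act_diag_swapSumFixing {k : ℕ} (d : Diagram (k + 1))
    (hd : d (Sum.inl (Fin.last k)) (Sum.inr (Fin.last k))) (f : (Fin (k + 1) → F) → ℤ)
    (w : Fin (k + 1) → F) : act (diag d) (swapSumFixing (Fin.last k) f) w
      = swapSumFixing (Fin.last k) (act (diag d) f) w := by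
  -- The condition on a and b depends on the last letter of the word acted on; as `d` preserves it,
  -- it can be frozen to that of `w`, leaving a fixed combination of letter permutations.
  rw [act_diag_congr (g := ∑ a : F, ∑ b : F,
    (if a ≠ w (Fin.last k) ∧ b ≠ w (Fin.last k) then (1 : ℤ) else 0) •
      fun u => f (Equiv.swap a b ∘ u)) d _ hd, swapSumFixing_last, act_sum_right, Finset.sum_apply]
  · refine Finset.sum_congr rfl fun a _ => ?_
    rw [act_sum_right, Finset.sum_apply]
    refine Finset.sum_congr rfl fun b _ => ?_
    rw [act_smul_right, Pi.smul_apply, smul_eq_mul, act_diag_comp_perm]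
  · intro u hu
    simp only [swapSumFixing_last, hu, Finset.sum_apply, Pi.smul_apply, smul_eq_mul]

/-- The scalar `c` may depend on the alphabet, and 2 cancels over ℤ, so commuting with `T` in every
representation is enough. -/
theorem commute_diag_of_act {x : PartitionAlgebra N} (d : Diagram N)
    (T : ∀ n, ((Fin N → Fin n) → ℤ) → (Fin N → Fin n) → ℤ)
    (hT : ∀ n, ∃ c : ℤ, ∀ f w, 2 * act x f w = T n f w + c * f w)
    (hd : ∀ n f w, act (diag d) (T n f) w = T n (act (diag d) f) w) :
    diag d * x = x * diag d := by
  refine eq_of_act_eq fun n f w => ?_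
  obtain ⟨c, hc⟩ := hT n
  have h : (2 : ℤ) • act x f = T n f + c • f := funext fun w => hc f w
  have h2 := congrFun (congrArg (act (diag d)) h) w
  rw [act_smul_right, act_add_right, act_smul_right, Pi.add_apply, hd] at h2
  rw [act_mul, act_mul]
  refine mul_left_cancel₀ (two_ne_zero (α := ℤ)) ?_
  rw [hc]
  exact h2

theorem diag_mul_zSucc {k : ℕ} (d : Diagram (k + 1)) : diag d * zSucc k = zSucc k * diag d :=
  commute_diag_of_act d (fun _ => swapSum (k + 1))
    (fun _ => act_sum_L_succ k.lt_succ_self (act_sum_LHalf k.lt_succ_self))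
    fun _ => act_diag_swapSum d

theorem diag_mul_zHalf {k : ℕ} (d : Diagram (k + 1))
    (hd : d (Sum.inl (Fin.last k)) (Sum.inr (Fin.last k))) : diag d * zHalf k = zHalf k * diag d :=
  commute_diag_of_act d (fun _ => swapSumFixing (Fin.last k))
    (fun _ => act_sum_LHalf k.lt_succ_self) fun _ => act_diag_swapSumFixing d hd

theorem zHalf_mem_halfAlgebra (k : ℕ) : zHalf k ∈ halfAlgebra k := by
  refine mem_halfAlgebra_of_wordRep fun n a b hab => ?_
  obtain ⟨c, hc⟩ := act_sum_LHalf (F := Fin n) k.lt_succ_self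
  have hsingle : ∀ u : Fin (k + 1) → Fin n, u (Fin.last k) = a (Fin.last k) →
      (Pi.single b 1 : (Fin (k + 1) → Fin n) → ℤ) u = 0 := fun u hu =>
    Pi.single_eq_of_ne (fun h => hab (by rw [← hu, h])) 1
  have h := hc (Pi.single b 1) a
  -- These swaps alter only letters before the last, so they never turn `a` into `b`.
  have h0 : swapSumFixing ⟨k, k.lt_succ_self⟩ (Pi.single b 1) a = 0 :=
    Finset.sum_eq_zero fun i _ => Finset.sum_eq_zero fun j _ => by
      rw [hsingle _ (by simp [mapPrefix]), ite_self]
  rw [hsingle a rfl, h0, mul_zero, add_zero, mul_eq_zero] at h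
  rw [wordRep_apply_eq_act]
  exact h.resolve_left two_ne_zero

theorem zSucc_mem_center (k : ℕ) : zSucc k ∈ Subalgebra.center ℤ[X] (PartitionAlgebra (k + 1)) := by
  rw [Subalgebra.mem_center_iff]
  intro x
  induction x using induction_smul_diag with
  | zero => rw [zero_mul, mul_zero]
  | add x y hx hy => rw [add_mul, mul_add, hx, hy]
  | smul_diag r d => rw [smul_mul_assoc, mul_smul_comm, diag_mul_zSucc]

theorem commute_zHalf_of_mem {k : ℕ} {x : PartitionAlgebra (k + 1)} (hx : x ∈ halfAlgebra k) :
    x * zHalf k = zHalf k * x := by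
  -- The centralizer is a subalgebra, so commuting with the generating diagrams suffices.
  have hle : halfAlgebra k ≤ Subalgebra.centralizer ℤ[X] {zHalf k} := by
    refine Algebra.adjoin_le ?_
    rintro _ ⟨d, hd, rfl⟩
    refine (Subalgebra.mem_centralizer_iff _).mpr fun y hy => ?_
    rw [Set.mem_singleton_iff.mp hy, diag_mul_zHalf d hd]
  exact ((Subalgebra.mem_centralizer_iff _).mp (hle hx) _ rfl).symm

end Center
end PartitionAlg

theorem mainTheorem4 (k : ℕ) :
    (∃ h : PartitionAlg.zHalf k ∈ PartitionAlg.halfAlgebra k,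
      (⟨PartitionAlg.zHalf k, h⟩ : PartitionAlg.halfAlgebra k) ∈
        Subalgebra.center (Polynomial ℤ) (PartitionAlg.halfAlgebra k)) ∧
    PartitionAlg.zSucc k ∈
      Subalgebra.center (Polynomial ℤ) (PartitionAlg.PartitionAlgebra (k + 1)) := by
  refine ⟨⟨PartitionAlg.zHalf_mem_halfAlgebra k, ?_⟩, PartitionAlg.zSucc_mem_center k⟩
  rw [Subalgebra.mem_center_iff]
  exact fun x => Subtype.ext (PartitionAlg.commute_zHalf_of_mem x.2)
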